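/- Let $\mathbb D$ be the open unit disc and $\mathbb T$ the unit circle with normalised Lebesgue measure. For $1\le p\le\infty$ let $H^p\subseteq L^p(\mathbb T)$ be the Hardy space of functions whose negative Fourier coefficients vanish; each $f\in H^p$ is identified with its holomorphic extension $f(z)=\sum_{n\ge 0}\hat f(n)z^n$, $z\in\mathbb D$. Let $\varphi\in H^\infty$ be an inner function ($|\varphi|=1$ a.e. on $\mathbb T$) with $\varphi(0)=0$. Let $H^2_\varphi$ be the closed linear span of $\{1,\varphi,\varphi^2,\dots\}$ in $H^2$, regarded as a Hilbert space of functions on $\mathbb D$, and let $H^\infty_\varphi$ be the weak$^*$-closed linear span of $\{1,\varphi,\varphi^2,\dots\}$ in $H^\infty$ (weak$^*$ topology of $L^\infty=(L^1)^*$). Then: 1. $\{\varphi^n : n\ge 0\}$ is an orthonormal basis of $H^2_\varphi$. 2. The reproducing kernel of $H^2_\varphi$ is $K^\varphi(z,w)=\dfrac{1}{1-\varphi(z)\overline{\varphi(w)}}$, $z,w\in\mathbb D$. 3. For $f\in H^\infty$ the following are equivalent: $f\in H^\infty_\varphi$; $f\in H^2_\varphi$; $f=g\circ\varphi$ on $\mathbb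 D$ for some $g\in H^\infty$ with $\|g\|_\infty=\|f\|_\infty$. Moreover, for every $g\in H^\infty$ the function $g\circ\varphi$ belongs to $H^\infty_\varphi$ and $\|g\circ\varphi\|_\infty=\|g\|_\infty$. 4. The multiplier algebra $\{f:\mathbb D\to\mathbb C \mid f\,h\in H^2_\varphi \text{ for all } h\in H^2_\varphi\}$ of $H^2_\varphi$ is $H^\infty_\varphi$, and for $f\in H^\infty_\varphi$ the operator of multiplication by $f$ on $H^2_\varphi$ has norm $\|f\|_\infty$. 5. $H^2_\varphi$ is a complete Nevanlinna–Pick space: for all integers $k,n\ge 0$, all points $z_1,\dots,z_n\in\mathbb D$ and all $k\times k$ complex matrices $W_1,\dots,W_n$, there is a function $F:\mathbb D\to M_k(\mathbb C)$ such that multiplication by $F$ is a contraction of the $k$-fold Hilbert space direct sum of $H^2_\varphi$ and $F(z_i)=W_i$ for all $i$, if and only if the block matrix $\big[(I-W_iW_j^*)K^\varphi(z_i,z_j)\big]_{i,j=1}^n$ is positive semidefinite. -/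

import Mathlib

open MeasureTheory Complex
open scoped ENNReal ComplexConjugate Topology Complex.UnitDisc ComplexOrder

noncomputable section

/-! ### Scalar reproducing kernel Hilbert spaces: multipliers and the complete Pick property -/

namespace RKHS

/-- The multiplier algebra of a scalar reproducing kernel Hilbert space `H` of functions on `X`:
all functions `f : X → ℂ` such that `f h ∈ H` for every `h ∈ H`. -/
def multiplierAlgebra {X : Type*} (H : Type*) [NormedAddCommGroup H] [InnerProductSpace ℂ H]
    [RKHS ℂ H X ℂ] : Subalgebra ℂ (X → ℂ) where
  carrier := {f | ∀ h : H, ∃ g : H, ∀ x : X, g x = f x * h x}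
  mul_mem' := by
    intro a b ha hb h
    obtain ⟨g, hg⟩ := hb h
    obtain ⟨k, hk⟩ := ha g
    exact ⟨k, fun x => by rw [hk, hg, Pi.mul_apply, mul_assoc]⟩
  add_mem' := by
    intro a b ha hb h
    obtain ⟨g, hg⟩ := hb h
    obtain ⟨k, hk⟩ := ha h
    exact ⟨k + g, fun x => by
      rw [RKHS.coe_add, Pi.add_apply, hk, hg, Pi.add_apply, add_mul]⟩
  algebraMap_mem' := by
    intro c h
    exact ⟨c • h, fun x => by simp [Pi.algebraMap_apply]⟩

/-- `F` is a `k × k` matrix-valued multiplier of `H` of norm at most one: pointwise multiplication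
by `F` is a contraction of the Hilbert space direct sum of `k` copies of `H`. -/
def IsContractiveMultiplier {X : Type*} (H : Type*) [NormedAddCommGroup H]
    [InnerProductSpace ℂ H] [RKHS ℂ H X ℂ] {k : ℕ} (F : X → Matrix (Fin k) (Fin k) ℂ) : Prop :=
  ∀ h : Fin k → H, ∃ g : Fin k → H,
    (∀ x i, g i x = ∑ j, F x i j * h j x) ∧ ∑ i, ‖g i‖ ^ 2 ≤ ∑ j, ‖h j‖ ^ 2

/-- The Pick matrix `[(I - W_i W_j^*) K(x_i, x_j)]`, an `n × n` block matrix with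
`k × k` blocks, `K` being the kernel of `H`. -/
def pickMatrix {X : Type*} (H : Type*) [NormedAddCommGroup H] [InnerProductSpace ℂ H]
    [CompleteSpace H] [RKHS ℂ H X ℂ] {n k : ℕ} (x : Fin n → X)
    (W : Fin n → Matrix (Fin k) (Fin k) ℂ) : Matrix (Fin n × Fin k) (Fin n × Fin k) ℂ :=
  Matrix.of fun p q =>
    (1 - W p.1 * (W q.1).conjTranspose) p.2 q.2 * kernel H (x p.1) (x q.1) 1

/-- `H` is a complete Nevanlinna-Pick space: for all matrix sizes `k`, all finite lists of nodes
`x_i` and all `k × k` targets `W_i`, there is a matrix-valued multiplier of norm at most one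
taking the values `W_i` at `x_i` if and only if the Pick matrix is positive semidefinite. -/
def IsCompleteNevanlinnaPick {X : Type*} (H : Type*) [NormedAddCommGroup H]
    [InnerProductSpace ℂ H] [CompleteSpace H] [RKHS ℂ H X ℂ] : Prop :=
  ∀ (k n : ℕ) (x : Fin n → X) (W : Fin n → Matrix (Fin k) (Fin k) ℂ),
    (∃ F : X → Matrix (Fin k) (Fin k) ℂ, IsContractiveMultiplier H F ∧ ∀ i, F (x i) = W i) ↔
      (pickMatrix H x W).PosSemidef

end RKHS

/-! ### Hardy spaces

The unit circle is parametrised as `t ↦ exp (2 π i t)`, `t ∈ ℝ / ℤ`; then `haarAddCircle` is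
normalised Lebesgue measure and `fourier n` is the monomial `ζ ^ n`. -/

/-- Normalised Lebesgue measure on the circle. -/
abbrev circleMeasure : Measure UnitAddCircle := AddCircle.haarAddCircle

theorem integrable_of_Lp {p : ℝ≥0∞} [Fact (1 ≤ p)] (f : Lp ℂ p circleMeasure) :
    Integrable f circleMeasure :=
  (Lp.memLp f).integrable Fact.out

/-- The Hardy space `H^p`, as a subspace of `L^p` of the circle: the functions all of whose
Fourier coefficients with negative index vanish. -/
def hardySpace (p : ℝ≥0∞) [Fact (1 ≤ p)] : Submodule ℂ (Lp ℂ p circleMeasure) where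
  carrier := {f | ∀ n : ℤ, n < 0 → fourierCoeff f n = 0}
  add_mem' := by
    intro f g hf hg n hn
    rw [fourierCoeff_congr_ae (Lp.coeFn_add f g),
      fourierCoeff.add (integrable_of_Lp f) (integrable_of_Lp g), Pi.add_apply, hf n hn, hg n hn,
      add_zero]
  zero_mem' := by
    intro n _
    rw [fourierCoeff_congr_ae (Lp.coeFn_zero ℂ p circleMeasure)]
    simp [fourierCoeff]
  smul_mem' := by
    intro c f hf n hn
    rw [fourierCoeff_congr_ae (Lp.coeFn_smul c f), fourierCoeff.const_smul, hf n hn, smul_zero]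

theorem mem_hardySpace {p : ℝ≥0∞} [Fact (1 ≤ p)] (f : Lp ℂ p circleMeasure) :
    f ∈ hardySpace p ↔ ∀ n : ℤ, n < 0 → fourierCoeff f n = 0 := Iff.rfl

/-- The holomorphic function on the unit disc with boundary function `f`:
its Taylor coefficients are the Fourier coefficients of `f` with nonnegative index. -/
def discExtension (f : UnitAddCircle → ℂ) (z : 𝔻) : ℂ :=
  ∑' n : ℕ, fourierCoeff f (n : ℤ) * (z : ℂ) ^ n

/-- The value at a point of the disc of an element of `H^∞`. -/
def hInfEval (f : hardySpace ∞) (z : 𝔻) : ℂ := discExtension (f : Lp ℂ ∞ circleMeasure) z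

/-! The space `H^2` as a reproducing kernel Hilbert space on the disc -/

theorem norm_fourierCoeff_le (f : Lp ℂ 2 circleMeasure) (n : ℤ) : ‖fourierCoeff f n‖ ≤ ‖f‖ := by
  rw [← fourierBasis_repr, HilbertBasis.repr_apply_apply]
  refine (norm_inner_le_norm _ _).trans ?_
  rw [fourierBasis.orthonormal.1 n, one_mul]

theorem norm_fourierCoeff_mul_pow_le (f : Lp ℂ 2 circleMeasure) (z : 𝔻) (n : ℕ) :
    ‖fourierCoeff f (n : ℤ) * (z : ℂ) ^ n‖ ≤ ‖f‖ * ‖(z : ℂ)‖ ^ n := by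
  rw [norm_mul, norm_pow]
  gcongr
  exact norm_fourierCoeff_le f n

theorem summable_fourierCoeff_mul_pow (f : Lp ℂ 2 circleMeasure) (z : 𝔻) :
    Summable fun n : ℕ => fourierCoeff f (n : ℤ) * (z : ℂ) ^ n :=
  Summable.of_norm_bounded
    ((summable_geometric_of_lt_one (norm_nonneg _) z.norm_lt_one).mul_left ‖f‖)
    (norm_fourierCoeff_mul_pow_le f z)

/-- Evaluation at a point of the disc, as a continuous linear functional on `H^2`. -/
def hardyEvalCLM (z : 𝔻) : hardySpace 2 →L[ℂ] ℂ :=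
  LinearMap.mkContinuous
    { toFun := fun f => discExtension (f : Lp ℂ 2 circleMeasure) z
      map_add' := by
        intro f g
        simp only [discExtension, Submodule.coe_add]
        rw [← (summable_fourierCoeff_mul_pow f.1 z).tsum_add (summable_fourierCoeff_mul_pow g.1 z)]
        refine tsum_congr fun n => ?_
        rw [fourierCoeff_congr_ae (Lp.coeFn_add f.1 g.1),
          fourierCoeff.add (integrable_of_Lp f.1) (integrable_of_Lp g.1), Pi.add_apply, add_mul]
      map_smul' := by
        intro c f
        simp only [discExtension, Submodule.coe_smul, RingHom.id_apply, smul_eq_mul]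
        rw [← tsum_mul_left]
        refine tsum_congr fun n => ?_
        rw [fourierCoeff_congr_ae (Lp.coeFn_smul c f.1), fourierCoeff.const_smul, smul_eq_mul,
          mul_assoc] }
    (1 - ‖(z : ℂ)‖)⁻¹ (by
      intro f
      rw [mul_comm]
      exact tsum_of_norm_bounded
        ((hasSum_geometric_of_lt_one (norm_nonneg _) z.norm_lt_one).mul_left ‖f‖)
        (norm_fourierCoeff_mul_pow_le f.1 z))

theorem hardyEvalCLM_injective (f : hardySpace 2) (hf : ∀ z, hardyEvalCLM z f = 0) : f = 0 := by
  set p := FormalMultilinearSeries.ofScalars ℂ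
    (fun n : ℕ => fourierCoeff (f : Lp ℂ 2 circleMeasure) (n : ℤ)) with hp
  have h0 : HasFPowerSeriesAt (0 : ℂ → ℂ) p 0 := by
    rw [hasFPowerSeriesAt_iff]
    filter_upwards [Metric.ball_mem_nhds (0 : ℂ) one_pos] with z hz
    have hz1 : ‖z‖ < 1 := by simpa using hz
    have hs := (summable_fourierCoeff_mul_pow f.1 (UnitDisc.mk z hz1)).hasSum
    have he : ∑' n : ℕ, fourierCoeff (f : Lp ℂ 2 circleMeasure) (n : ℤ) *
        ((UnitDisc.mk z hz1 : 𝔻) : ℂ) ^ n = 0 := hf (UnitDisc.mk z hz1)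
    rw [he] at hs
    simpa [hp, mul_comm] using hs
  have hc : ∀ n : ℕ, fourierCoeff (f : Lp ℂ 2 circleMeasure) (n : ℤ) = 0 := by
    intro n
    have h1 : p.coeff n = 0 := by rw [h0.eq_zero]; rfl
    simpa [hp] using h1
  apply Subtype.ext
  apply fourierBasis.repr.injective
  ext i
  rw [fourierBasis_repr]
  rcases lt_or_ge i 0 with hi | hi
  · simp [f.2 i hi]
  · lift i to ℕ using hi
    simp [hc i]

/-- `H^2` as a Hilbert space of functions on the disc. -/
instance instRKHSHardy : RKHS ℂ (hardySpace 2) 𝔻 ℂ where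
  coeCLM := ContinuousLinearMap.pi hardyEvalCLM
  coeCLM_injective := by
    refine (injective_iff_map_eq_zero (ContinuousLinearMap.pi hardyEvalCLM)).mpr fun f hf => ?_
    exact hardyEvalCLM_injective f fun z => congrFun hf z

theorem isClosed_hardySpace_two : IsClosed (hardySpace 2 : Set (Lp ℂ 2 circleMeasure)) := by
  have : (hardySpace 2 : Set (Lp ℂ 2 circleMeasure)) =
      ⋂ (n : ℤ) (_ : n < 0), {f | inner ℂ (fourierBasis n) f = 0} := by
    ext f
    simp only [SetLike.mem_coe, mem_hardySpace, Set.mem_iInter, Set.mem_ofPred_eq,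
      ← HilbertBasis.repr_apply_apply, fourierBasis_repr]
  rw [this]
  exact isClosed_iInter fun n => isClosed_iInter fun _ =>
    isClosed_eq (by fun_prop) continuous_const

instance instCompleteSpaceHardy : CompleteSpace (hardySpace 2) :=
  isClosed_hardySpace_two.completeSpace_coe

/-- The inclusion of `H^∞` in `H^2`. -/
def hInfToH2 (f : hardySpace ∞) : hardySpace 2 :=
  ⟨((Lp.memLp f.1).mono_exponent le_top).toLp f.1, fun n hn => by
    rw [fourierCoeff_congr_ae (MemLp.coeFn_toLp _)]
    exact f.2 n hn⟩

/-! ### Powers of an element of `H^∞` -/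

theorem fourierCoeff_mul_eq_zero {f g : UnitAddCircle → ℂ} (hf : MemLp f 2 circleMeasure)
    (hg : MemLp g 2 circleMeasure) (hf0 : ∀ n : ℤ, n < 0 → fourierCoeff f n = 0)
    (hg0 : ∀ n : ℤ, n < 0 → fourierCoeff g n = 0) (n : ℤ) (hn : n < 0) :
    fourierCoeff (fun t => f t * g t) n = 0 := by
  have hu : MemLp (fun t => conj (fourier (-n) t * f t)) 2 circleMeasure := by
    refine hf.of_le ?_ (Filter.Eventually.of_forall fun t => ?_)
    · exact continuous_star.comp_aestronglyMeasurable
        ((fourier (-n)).continuous.aestronglyMeasurable.mul hf.1)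
    · rw [RCLike.norm_conj, norm_mul, fourier_apply, Circle.norm_coe, one_mul]
  have key : ∀ v : Lp ℂ 2 circleMeasure, inner ℂ (hu.toLp _) v =
      ∫ t, fourier (-n) t * f t * v t ∂circleMeasure := by
    intro v
    rw [L2.inner_def]
    refine integral_congr_ae ?_
    filter_upwards [hu.coeFn_toLp] with t ht
    rw [ht, RCLike.inner_apply', RCLike.conj_conj]
  have h1 : fourierCoeff (fun t => f t * g t) n = inner ℂ (hu.toLp _) (hg.toLp g) := by
    rw [key]
    refine integral_congr_ae ?_
    filter_upwards [hg.coeFn_toLp] with t ht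
    rw [ht, smul_eq_mul, mul_assoc]
  have h2 := (innerSL ℂ (hu.toLp _)).hasSum (hasSum_fourier_series_L2 (hg.toLp g))
  have h3 : ∀ m : ℤ, (innerSL ℂ (hu.toLp _))
      (fourierCoeff (hg.toLp g) m • fourierLp 2 m) = 0 := by
    intro m
    rw [map_smul, fourierCoeff_congr_ae hg.coeFn_toLp]
    rcases lt_or_ge m 0 with hm | hm
    · rw [hg0 m hm, zero_smul]
    · have : (innerSL ℂ (hu.toLp _)) (fourierLp 2 m) = fourierCoeff f (n - m) := by
        rw [innerSL_apply_apply, key]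
        refine integral_congr_ae ?_
        filter_upwards [coeFn_fourierLp 2 m] with t ht
        rw [ht, smul_eq_mul, neg_sub, sub_eq_add_neg, fourier_add]
        ring
      rw [this, hf0 _ (by lia), smul_zero]
  rw [h1]
  refine h2.unique ?_
  simp only [h3]
  exact hasSum_zero

theorem memLp_pow (f : Lp ℂ ∞ circleMeasure) (n : ℕ) :
    MemLp (fun t => f t ^ n) ∞ circleMeasure := by
  induction n with
  | zero => simpa using memLp_const (1 : ℂ)
  | succ n ih => simpa only [pow_succ] using (Lp.memLp f).mul' ih

theorem fourierCoeff_pow_eq_zero (f : hardySpace ∞) (n : ℕ) :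
    ∀ m : ℤ, m < 0 → fourierCoeff (fun t => (f : Lp ℂ ∞ circleMeasure) t ^ n) m = 0 := by
  induction n with
  | zero =>
    intro m hm
    have h := congrFun (fourierCoeff_fourier (T := 1) 0) m
    rw [Pi.single_eq_of_ne hm.ne] at h
    rw [← h]
    congr 1
    ext t
    simp
  | succ n ih =>
    intro m hm
    simp only [pow_succ]
    exact fourierCoeff_mul_eq_zero ((memLp_pow f.1 n).mono_exponent le_top)
      ((Lp.memLp f.1).mono_exponent le_top) ih f.2 m hm

/-- The power `f ^ n` of an element `f` of `H^∞`. -/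
def hInfPow (f : hardySpace ∞) (n : ℕ) : hardySpace ∞ :=
  ⟨(memLp_pow f.1 n).toLp _, fun m hm => by
    rw [fourierCoeff_congr_ae (MemLp.coeFn_toLp _)]
    exact fourierCoeff_pow_eq_zero f n m hm⟩

/-- An inner function: an element of `H^∞` which is unimodular almost everywhere on the circle. -/
def IsInnerFunction (φ : hardySpace ∞) : Prop :=
  ∀ᵐ t ∂circleMeasure, ‖(φ : Lp ℂ ∞ circleMeasure) t‖ = 1

/-- The functions `f` and `g ∘ φ` agree on the disc: for every `z` in the disc, `φ z` lies in the
disc and `f z = g (φ z)`. -/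
def IsCompOnDisc (f g φ : hardySpace ∞) : Prop :=
  ∀ z : 𝔻, ∃ w : 𝔻, (w : ℂ) = hInfEval φ z ∧ hInfEval f z = hInfEval g w

/-! ### The spaces generated by the powers of a function -/

/-- The space `H^2_φ`: the closed span in `H^2` of the powers of `φ`. -/
def hardyTwoOf (φ : hardySpace ∞) : Submodule ℂ (hardySpace 2) :=
  (Submodule.span ℂ (Set.range fun n : ℕ => hInfToH2 (hInfPow φ n))).topologicalClosure

instance instCompleteSpaceHardyTwoOf (φ : hardySpace ∞) : CompleteSpace (hardyTwoOf φ) :=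
  (Submodule.isClosed_topologicalClosure _).completeSpace_coe

/-- `H^2_φ` as a Hilbert space of functions on the disc. -/
instance instRKHSHardyTwoOf (φ : hardySpace ∞) : RKHS ℂ (hardyTwoOf φ) 𝔻 ℂ where
  coeCLM := (RKHS.coeCLM (H := hardySpace 2) ℂ).comp (hardyTwoOf φ).subtypeL
  coeCLM_injective := (RKHS.coeCLM_injective (H := hardySpace 2)).comp Subtype.val_injective

/-- The weak-star topology of `H^∞`, that is, the restriction of the weak-star topology of `L^∞`
as the dual of `L^1`: the coarsest topology for which `f ↦ ∫ f h` is continuous for all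
`h ∈ L^1`. -/
abbrev hInfWeakStar : TopologicalSpace (hardySpace ∞) :=
  TopologicalSpace.induced
    (fun (f : hardySpace ∞) (h : Lp ℂ 1 circleMeasure) =>
      ∫ t, (f : Lp ℂ ∞ circleMeasure) t * h t ∂circleMeasure)
    Pi.topologicalSpace

/-- The space `H^∞_φ`: the weak-star closed span in `H^∞` of the powers of `φ`. -/
def hardyInfOf (φ : hardySpace ∞) : Set (hardySpace ∞) :=
  closure[hInfWeakStar]
    (Submodule.span ℂ (Set.range fun n : ℕ => hInfPow φ n) : Set (hardySpace ∞))

end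

/-! Everything is transported along composition with φ. The unimodular boundary values of φ define
almost everywhere a map τ of the circle to itself (`boundaryMap`). Its push-forward of Lebesgue
measure has Fourier coefficients ∫ φ^n = φ(0)^n = 0 for n > 0, so τ preserves measure
(`measurePreserving_boundaryMap`). Hence g ↦ g ∘ τ is isometric on every L^p. It sends z^n to φ^n,
and therefore maps H^2 isometrically onto H^2_φ (`mem_hardyTwoOf_iff`). The powers of φ are thus an
orthonormal basis, and the kernel is the geometric series in φ(z) times the conjugate of φ(w).
Evaluating the expansion of g ∘ τ in powers of φ identifies composition on the circle with
composition on the disc (`hardyEvalCLM_compH2`).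

For H^∞, pairing with an element of H^2 is weak-star continuous, so the weak-star closure lies in
H^2_φ. An element of H^2_φ ∩ H^∞ has the form g ∘ τ, with g bounded because τ preserves measure.
Conversely, g is a bounded almost everywhere limit of polynomials p_k (`exists_polynomial_tendsto`),
so the p_k(φ) converge weak-star to g ∘ τ.

A multiplier of H^2_φ is the image of 1, hence of the form g ∘ τ, and pulling back along τ makes
multiplication by g bounded on polynomials in L^2 of the circle. This forces |g| to be at most the
operator norm (`ae_norm_le_of_forall_polynomial`).

In the Pick theorem, necessity is contractivity of the adjoint multiplier on combinations of kernel
functions. Sufficiency is the lurking isometry argument: a Gram factorisation of the Pick matrix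
yields a contractive colligation whose transfer function, evaluated at φ(z), interpolates. It is a
contractive multiplier because the associated linear system does not increase energy. -/

noncomputable section

/-! ### Products of Hardy functions and their disc extensions -/

theorem hasSum_fourierCoeff_mul {f g : UnitAddCircle → ℂ} (hf : MemLp f 2 circleMeasure)
    (hg : MemLp g 2 circleMeasure) (n : ℤ) :
    HasSum (fun m : ℤ => fourierCoeff g m * fourierCoeff f (n - m))
      (fourierCoeff (fun t => f t * g t) n) := by
  -- The n-th coefficient of f g is the inner product of this L^2 function with g; expanding g in
  -- its Fourier series gives the convolution formula.
  have hu : MemLp (fun t => conj (fourier (-n) t * f t)) 2 circleMeasure := by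
    refine hf.of_le ?_ (Filter.Eventually.of_forall fun t => ?_)
    · exact continuous_star.comp_aestronglyMeasurable
        ((fourier (-n)).continuous.aestronglyMeasurable.mul hf.1)
    · rw [RCLike.norm_conj, norm_mul, fourier_apply, Circle.norm_coe, one_mul]
  have key : ∀ v : Lp ℂ 2 circleMeasure, inner ℂ (hu.toLp _) v =
      ∫ t, fourier (-n) t * f t * v t ∂circleMeasure := by
    intro v
    rw [L2.inner_def]
    refine integral_congr_ae ?_
    filter_upwards [hu.coeFn_toLp] with t ht
    rw [ht, RCLike.inner_apply', RCLike.conj_conj]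
  have h1 : fourierCoeff (fun t => f t * g t) n = inner ℂ (hu.toLp _) (hg.toLp g) := by
    rw [key]
    refine integral_congr_ae ?_
    filter_upwards [hg.coeFn_toLp] with t ht
    rw [ht, smul_eq_mul, mul_assoc]
  have h2 := (innerSL ℂ (hu.toLp _)).hasSum (hasSum_fourier_series_L2 (hg.toLp g))
  have h3 : ∀ m : ℤ, (innerSL ℂ (hu.toLp _))
      (fourierCoeff (hg.toLp g) m • fourierLp 2 m) = fourierCoeff g m * fourierCoeff f (n - m) := by
    intro m
    rw [map_smul, fourierCoeff_congr_ae hg.coeFn_toLp, smul_eq_mul]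
    congr 1
    rw [innerSL_apply_apply, key]
    refine integral_congr_ae ?_
    filter_upwards [coeFn_fourierLp 2 m] with t ht
    rw [ht, smul_eq_mul, neg_sub, sub_eq_add_neg, fourier_add]
    ring
  rw [h1]
  simp only [h3] at h2
  exact h2

/-- Square integrable functions whose negative Fourier coefficients vanish. -/
structure IsHardy (f : UnitAddCircle → ℂ) : Prop where
  memLp : MemLp f 2 circleMeasure
  coeff_eq_zero : ∀ n : ℤ, n < 0 → fourierCoeff f n = 0

theorem IsHardy.of_hardySpace_two (f : hardySpace 2) :
    IsHardy (f : Lp ℂ 2 circleMeasure) := ⟨Lp.memLp f.1, f.2⟩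

theorem IsHardy.of_hardySpace_top (f : hardySpace ∞) :
    IsHardy (f : Lp ℂ ∞ circleMeasure) := ⟨(Lp.memLp f.1).mono_exponent le_top, f.2⟩

/-- The element of `H^2` defined by a function. -/
def IsHardy.toH2 {f : UnitAddCircle → ℂ} (hf : IsHardy f) : hardySpace 2 :=
  ⟨hf.memLp.toLp f, fun n hn => by
    rw [fourierCoeff_congr_ae hf.memLp.coeFn_toLp]; exact hf.coeff_eq_zero n hn⟩

theorem IsHardy.coeFn_toH2 {f : UnitAddCircle → ℂ} (hf : IsHardy f) :
    (hf.toH2 : Lp ℂ 2 circleMeasure) =ᵐ[circleMeasure] f := hf.memLp.coeFn_toLp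

theorem discExtension_congr_ae {f g : UnitAddCircle → ℂ} (h : f =ᵐ[circleMeasure] g) (z : 𝔻) :
    discExtension f z = discExtension g z := by
  simp only [discExtension, fourierCoeff_congr_ae h]

/-- In the convolution over ℤ only the indices 0 ≤ m ≤ n survive, because both factors have no
negative frequencies. -/
theorem IsHardy.fourierCoeff_mul {f g : UnitAddCircle → ℂ} (hf : IsHardy f) (hg : IsHardy g)
    (n : ℕ) : fourierCoeff (fun t => f t * g t) (n : ℤ) =
      ∑ p ∈ Finset.HasAntidiagonal.antidiagonal n,
        fourierCoeff f (p.1 : ℤ) * fourierCoeff g (p.2 : ℤ) := by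
  have h := hasSum_fourierCoeff_mul hf.memLp hg.memLp n
  have h2 := hasSum_sum_of_ne_finset_zero (L := SummationFilter.unconditional ℤ)
    (f := fun m : ℤ => fourierCoeff g m *
    fourierCoeff f (n - m)) (s := (Finset.range (n + 1)).map Nat.castEmbedding) (by
      intro m hm
      rcases lt_or_ge m 0 with h0 | h0
      · rw [hg.coeff_eq_zero m h0, zero_mul]
      · rw [hf.coeff_eq_zero _ _, mul_zero]
        lift m to ℕ using h0
        by_contra hc
        apply hm
        simp only [Finset.mem_map, Finset.mem_range, Nat.castEmbedding_apply]
        exact ⟨m, by lia, rfl⟩)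
  rw [h.unique h2, Finset.sum_map, ← Finset.Nat.sum_antidiagonal_swap,
    Finset.Nat.sum_antidiagonal_eq_sum_range_succ_mk]
  refine Finset.sum_congr rfl fun m hm => ?_
  rw [Finset.mem_range] at hm
  simp only [Nat.castEmbedding_apply, Prod.fst_swap, Prod.snd_swap]
  rw [mul_comm, Nat.cast_sub (by lia)]

theorem IsHardy.summable_norm {f : UnitAddCircle → ℂ} (hf : IsHardy f) (z : 𝔻) :
    Summable fun n : ℕ => ‖fourierCoeff f (n : ℤ) * (z : ℂ) ^ n‖ := by
  refine Summable.of_nonneg_of_le (fun _ => norm_nonneg _) (fun n => ?_)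
    ((summable_geometric_of_lt_one (norm_nonneg _) z.norm_lt_one).mul_left ‖hf.memLp.toLp f‖)
  rw [← fourierCoeff_congr_ae hf.memLp.coeFn_toLp]
  exact norm_fourierCoeff_mul_pow_le _ z n

theorem IsHardy.hasSum_discExtension {f : UnitAddCircle → ℂ} (hf : IsHardy f) (z : 𝔻) :
    HasSum (fun n : ℕ => fourierCoeff f (n : ℤ) * (z : ℂ) ^ n) (discExtension f z) :=
  (hf.summable_norm z).of_norm.hasSum

/-- By `IsHardy.fourierCoeff_mul` this is the Cauchy product of two absolutely convergent power
series. -/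
theorem IsHardy.discExtension_mul {f g : UnitAddCircle → ℂ} (hf : IsHardy f) (hg : IsHardy g)
    (z : 𝔻) : discExtension (fun t => f t * g t) z = discExtension f z * discExtension g z := by
  rw [discExtension, discExtension, discExtension,
    tsum_mul_tsum_eq_tsum_sum_antidiagonal_of_summable_norm (hf.summable_norm z)
      (hg.summable_norm z)]
  refine tsum_congr fun n => ?_
  rw [hf.fourierCoeff_mul hg, Finset.sum_mul]
  refine Finset.sum_congr rfl fun p hp => ?_
  rw [← Finset.HasAntidiagonal.mem_antidiagonal.1 hp, pow_add]
  ring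

theorem IsHardy.mul {f g : UnitAddCircle → ℂ} (hf : IsHardy f) (hg : IsHardy g)
    (hfg : MemLp (fun t => f t * g t) 2 circleMeasure) : IsHardy fun t => f t * g t :=
  ⟨hfg, fourierCoeff_mul_eq_zero hf.memLp hg.memLp hf.coeff_eq_zero hg.coeff_eq_zero⟩

theorem IsHardy.top_mul (f : hardySpace ∞) {g : UnitAddCircle → ℂ} (hg : IsHardy g) :
    IsHardy fun t => (f : Lp ℂ ∞ circleMeasure) t * g t :=
  (IsHardy.of_hardySpace_top f).mul hg (hg.memLp.mul' (Lp.memLp f.1))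

theorem coeFn_hInfPow (f : hardySpace ∞) (n : ℕ) :
    ((hInfPow f n : hardySpace ∞) : Lp ℂ ∞ circleMeasure) =ᵐ[circleMeasure]
      fun t => (f : Lp ℂ ∞ circleMeasure) t ^ n := (memLp_pow f.1 n).coeFn_toLp

theorem coeFn_hInfToH2 (f : hardySpace ∞) :
    ((hInfToH2 f : hardySpace 2) : Lp ℂ 2 circleMeasure) =ᵐ[circleMeasure]
      (f : Lp ℂ ∞ circleMeasure) := ((Lp.memLp f.1).mono_exponent le_top).coeFn_toLp

theorem hardyEvalCLM_apply (z : 𝔻) (f : hardySpace 2) :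
    hardyEvalCLM z f = discExtension (f : Lp ℂ 2 circleMeasure) z := rfl

theorem hardyEvalCLM_hInfToH2 (z : 𝔻) (f : hardySpace ∞) :
    hardyEvalCLM z (hInfToH2 f) = hInfEval f z := discExtension_congr_ae (coeFn_hInfToH2 f) z

theorem hardyEvalCLM_toH2 (z : 𝔻) {f : UnitAddCircle → ℂ} (hf : IsHardy f) :
    hardyEvalCLM z hf.toH2 = discExtension f z := discExtension_congr_ae hf.coeFn_toH2 z

theorem eq_of_hardyEvalCLM_eq {f g : hardySpace 2} (h : ∀ z, hardyEvalCLM z f = hardyEvalCLM z g) :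
    f = g :=
  sub_eq_zero.1 (hardyEvalCLM_injective _ fun z => by rw [map_sub, h, sub_self])

theorem hInfToH2_injective : Function.Injective hInfToH2 := by
  intro f g h
  apply Subtype.ext
  apply Lp.ext
  exact (coeFn_hInfToH2 f).symm.trans ((by rw [h] : _ =ᵐ[circleMeasure] _).trans (coeFn_hInfToH2 g))

theorem discExtension_const (c : ℂ) (z : 𝔻) : discExtension (fun _ => c) z = c := by
  have h : ∀ n : ℤ, fourierCoeff (fun _ : UnitAddCircle => c) n = if n = 0 then c else 0 := by
    intro n
    have h := congrFun (fourierCoeff_fourier (T := 1) 0) n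
    have h2 : (fun _ : UnitAddCircle => c) = c • (fourier 0 : UnitAddCircle → ℂ) := by
      ext t; simp
    rw [h2, fourierCoeff.const_smul, h]
    simp [Pi.single_apply]
  rw [discExtension, tsum_eq_single 0]
  · simp [h]
  · intro n hn
    simp [h, hn]

theorem hInfEval_hInfPow (f : hardySpace ∞) (n : ℕ) (z : 𝔻) :
    hInfEval (hInfPow f n) z = hInfEval f z ^ n := by
  induction n with
  | zero =>
    rw [hInfEval, discExtension_congr_ae (coeFn_hInfPow f 0)]
    simpa using discExtension_const 1 z
  | succ n ih =>
    rw [pow_succ, ← ih, hInfEval, hInfEval, hInfEval,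
      ← (IsHardy.of_hardySpace_top _).discExtension_mul
      (IsHardy.of_hardySpace_top f)]
    refine discExtension_congr_ae ?_ z
    filter_upwards [coeFn_hInfPow f n, coeFn_hInfPow f (n + 1)] with t h1 h2
    rw [h1, h2, pow_succ]

/-! ### Sup-norm bounds on the circle and in the disc -/

theorem norm_coeFn_le (f : Lp ℂ ∞ circleMeasure) : ∀ᵐ t ∂circleMeasure, ‖f t‖ ≤ ‖f‖ := by
  have := ae_le_eLpNormEssSup (f := f) (μ := circleMeasure)
  filter_upwards [this] with t ht
  rw [Lp.norm_def, eLpNorm_exponent_top]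
  rw [← toReal_enorm]
  exact ENNReal.toReal_mono (by simpa using (Lp.eLpNorm_lt_top f).ne) ht

theorem norm_top_le_of_ae (f : Lp ℂ ∞ circleMeasure) {C : ℝ} (hC : 0 ≤ C)
    (h : ∀ᵐ t ∂circleMeasure, ‖f t‖ ≤ C) : ‖f‖ ≤ C := by
  simpa [measureUnivNNReal] using Lp.norm_le_of_ae_bound hC h

theorem norm_two_le_of_ae (f : Lp ℂ 2 circleMeasure) {C : ℝ} (hC : 0 ≤ C)
    (h : ∀ᵐ t ∂circleMeasure, ‖f t‖ ≤ C) : ‖f‖ ≤ C := by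
  simpa [measureUnivNNReal] using Lp.norm_le_of_ae_bound hC h

theorem norm_hardyEvalCLM_le (z : 𝔻) (f : hardySpace 2) :
    ‖hardyEvalCLM z f‖ ≤ (1 - ‖(z : ℂ)‖)⁻¹ * ‖f‖ := by
  refine (hardyEvalCLM z).le_of_opNorm_le ?_ f
  exact LinearMap.mkContinuous_norm_le _ (inv_nonneg.2 (by linarith [z.norm_lt_one])) _

/-- If all powers of `a` are bounded by `K * C ^ n` then `a ≤ C`. -/
theorem le_of_forall_pow_le {a C K : ℝ} (hC : 0 ≤ C)
    (h : ∀ n : ℕ, a ^ n ≤ K * C ^ n) : a ≤ C := by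
  by_contra! hlt
  rcases hC.eq_or_lt with rfl | hC
  · have := h 1
    simp at this
    linarith
  · have h1 : 1 < a / C := (one_lt_div hC).2 hlt
    obtain ⟨n, hn⟩ := pow_unbounded_of_one_lt K h1
    rw [div_pow, lt_div_iff₀ (pow_pos hC n)] at hn
    linarith [h n]

/-- A maximum principle obtained from powers: boundedness of evaluation on H^2, applied to f^n,
gives |f(z)|^n ≤ K ‖f‖^n with K independent of n, and K disappears on taking n-th roots. -/
theorem norm_hInfEval_le (f : hardySpace ∞) (z : 𝔻) : ‖hInfEval f z‖ ≤ ‖f‖ := by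
  refine le_of_forall_pow_le (K := (1 - ‖(z : ℂ)‖)⁻¹) (norm_nonneg _) fun n => ?_
  rw [← norm_pow, ← hInfEval_hInfPow, ← hardyEvalCLM_hInfToH2]
  refine (norm_hardyEvalCLM_le z _).trans ?_
  refine mul_le_mul_of_nonneg_left ?_ (inv_nonneg.2 (by linarith [z.norm_lt_one]))
  change ‖(hInfToH2 (hInfPow f n)).1‖ ≤ _
  refine norm_two_le_of_ae _ (by positivity) ?_
  filter_upwards [coeFn_hInfToH2 (hInfPow f n), coeFn_hInfPow f n, norm_coeFn_le f.1]
    with t h1 h2 h3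
  rw [h1, h2, norm_pow]
  exact pow_le_pow_left₀ (norm_nonneg _) h3 n

theorem hasSum_hardySpace_two (f : hardySpace 2) :
    HasSum (fun n : ℕ => fourierCoeff (f : Lp ℂ 2 circleMeasure) (n : ℤ) • fourierLp 2 (n : ℤ))
      (f : Lp ℂ 2 circleMeasure) := by
  have hinj : Function.Injective (Nat.cast : ℕ → ℤ) := Nat.cast_injective
  have h := (hinj.hasSum_iff (f := fun n : ℤ =>
    fourierCoeff (f : Lp ℂ 2 circleMeasure) n • (fourierLp 2 n : Lp ℂ 2 circleMeasure))
    (a := (f : Lp ℂ 2 circleMeasure)) ?_).2 (hasSum_fourier_series_L2 (f : Lp ℂ 2 circleMeasure))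
  · exact h
  · intro n hn
    have : n < 0 := by
      by_contra! h0
      lift n to ℕ using h0
      exact hn ⟨n, rfl⟩
    rw [f.2 n this, zero_smul]

/-! ### The measure-preserving boundary map of an inner function -/

/-- Finite measures on the circle with the same Fourier-Stieltjes coefficients are equal. -/
theorem measure_ext_of_integral_fourier {μ ν : Measure UnitAddCircle} [IsFiniteMeasure μ]
    [IsFiniteMeasure ν]
    (h : ∀ n : ℤ, ∫ t, (fourier n : C(UnitAddCircle, ℂ)) t ∂μ =
      ∫ t, (fourier n : C(UnitAddCircle, ℂ)) t ∂ν) : μ = ν := by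
  have hint : ∀ (ρ : Measure UnitAddCircle) [IsFiniteMeasure ρ] (f : C(UnitAddCircle, ℂ)),
      Integrable f ρ := fun ρ _ f => f.continuous.integrable_of_hasCompactSupport
        (HasCompactSupport.of_compactSpace _)
  have hcont : ∀ (ρ : Measure UnitAddCircle) [IsFiniteMeasure ρ],
      Continuous fun f : C(UnitAddCircle, ℂ) => ∫ t, f t ∂ρ := by
    intro ρ _
    have := (continuous_integral (μ := ρ) (G := ℂ)).comp
      (ContinuousMap.toLp (E := ℂ) 1 ρ ℂ).continuous
    refine this.congr fun f => ?_
    simp only [Function.comp_apply]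
    exact integral_congr_ae (ContinuousMap.coeFn_toLp ρ f)
  -- Trigonometric polynomials are uniformly dense in the continuous functions, and both integrals
  -- are continuous in the uniform norm.
  have hall : ∀ f : C(UnitAddCircle, ℂ), ∫ t, f t ∂μ = ∫ t, f t ∂ν := by
    intro f
    have hf : f ∈ (Submodule.span ℂ (Set.range (@fourier 1))).topologicalClosure := by
      rw [span_fourier_closure_eq_top]; trivial
    refine closure_minimal (s := (Submodule.span ℂ (Set.range (@fourier 1)) :
      Set C(UnitAddCircle, ℂ))) (t := {f | ∫ t, f t ∂μ = ∫ t, f t ∂ν}) ?_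
      (isClosed_eq (hcont μ) (hcont ν)) hf
    intro g hg
    induction hg using Submodule.span_induction with
    | mem x hx => obtain ⟨n, rfl⟩ := hx; exact h n
    | zero => simp
    | add x y _ _ hx hy =>
      simp only [Set.mem_ofPred_eq, ContinuousMap.add_apply] at *
      rw [integral_add (hint μ x) (hint μ y), integral_add (hint ν x) (hint ν y), hx, hy]
    | smul c x _ hx =>
      simp only [Set.mem_ofPred_eq, ContinuousMap.smul_apply] at *
      rw [integral_smul, integral_smul, hx]
  refine ext_of_forall_integral_eq_of_IsFiniteMeasure fun f => ?_
  have := hall ⟨fun t => (f t : ℂ), by fun_prop⟩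
  simp only [ContinuousMap.coe_mk] at this
  rw [integral_complex_ofReal, integral_complex_ofReal] at this
  exact_mod_cast this

/-- The boundary map of a function on the circle: `boundaryMap φ t` is the point of `ℝ / ℤ` with
the argument of `φ t`. -/
def boundaryMap (φ : hardySpace ∞) (t : UnitAddCircle) : UnitAddCircle :=
  ((Complex.arg ((φ : Lp ℂ ∞ circleMeasure) t) / (2 * Real.pi) : ℝ) : UnitAddCircle)

theorem measurable_boundaryMap (φ : hardySpace ∞) : Measurable (boundaryMap φ) := by
  have h : Measurable ((φ : Lp ℂ ∞ circleMeasure) : UnitAddCircle → ℂ) :=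
    (Lp.stronglyMeasurable φ.1).measurable
  have h2 : Measurable (fun x : ℝ => (x : UnitAddCircle)) :=
    (AddCircle.continuous_mk' 1).measurable
  exact h2.comp ((Complex.measurable_arg.comp h).div_const _)

theorem toCircle_boundaryMap {φ : hardySpace ∞} {t : UnitAddCircle}
    (ht : ‖(φ : Lp ℂ ∞ circleMeasure) t‖ = 1) :
    (AddCircle.toCircle (boundaryMap φ t) : ℂ) = (φ : Lp ℂ ∞ circleMeasure) t := by
  have h := Complex.norm_mul_exp_arg_mul_I ((φ : Lp ℂ ∞ circleMeasure) t)
  rw [ht, Complex.ofReal_one, one_mul] at h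
  rw [boundaryMap, AddCircle.toCircle_apply_mk, Circle.coe_exp, div_one,
    mul_div_cancel₀ _ (by positivity), h]

theorem fourier_boundaryMap {φ : hardySpace ∞} {t : UnitAddCircle}
    (ht : ‖(φ : Lp ℂ ∞ circleMeasure) t‖ = 1) (n : ℕ) :
    (fourier (n : ℤ) (boundaryMap φ t) : ℂ) = (φ : Lp ℂ ∞ circleMeasure) t ^ n := by
  rw [fourier_apply, natCast_zsmul, AddCircle.toCircle_nsmul, Circle.coe_pow,
    toCircle_boundaryMap ht]

theorem discExtension_zero (f : UnitAddCircle → ℂ) :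
    discExtension f 0 = ∫ t, f t ∂circleMeasure := by
  rw [discExtension, tsum_eq_single 0]
  · simp [fourierCoeff]
  · intro n hn
    simp [hn]

theorem integral_pow_eq_zero {φ : hardySpace ∞} (hφ0 : hInfEval φ 0 = 0) {n : ℕ} (hn : n ≠ 0) :
    ∫ t, (φ : Lp ℂ ∞ circleMeasure) t ^ n ∂circleMeasure = 0 := by
  have h := hInfEval_hInfPow φ n 0
  rw [hφ0, zero_pow hn, hInfEval, discExtension_zero, integral_congr_ae (coeFn_hInfPow φ n)] at h
  exact h

/-- Löwner's lemma. The n-th Fourier–Stieltjes coefficient of the push-forward is ∫ φ^n, which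
vanishes for n > 0 because φ(0) = 0; negative frequencies follow by conjugation. -/
theorem measurePreserving_boundaryMap {φ : hardySpace ∞} (hφ : IsInnerFunction φ)
    (hφ0 : hInfEval φ 0 = 0) :
    MeasurePreserving (boundaryMap φ) circleMeasure circleMeasure := by
  refine ⟨measurable_boundaryMap φ, ?_⟩
  have hm := measurable_boundaryMap φ
  have := Measure.isFiniteMeasure_map circleMeasure (boundaryMap φ)
  have key : ∀ n : ℕ, ∫ t, (fourier (n : ℤ) : C(UnitAddCircle, ℂ)) t
      ∂(circleMeasure.map (boundaryMap φ)) =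
      ∫ t, (fourier (n : ℤ) : C(UnitAddCircle, ℂ)) t ∂circleMeasure := by
    intro n
    rw [integral_map hm.aemeasurable (fourier (n : ℤ)).continuous.aestronglyMeasurable]
    rw [integral_congr_ae (g := fun t => (φ : Lp ℂ ∞ circleMeasure) t ^ n)
      (by filter_upwards [hφ] with t ht using fourier_boundaryMap ht n)]
    rcases eq_or_ne n 0 with rfl | hn
    · simp
    · rw [integral_pow_eq_zero hφ0 hn]
      have h := congrFun (fourierCoeff_fourier (T := 1) (n : ℤ)) 0
      rw [Pi.single_eq_of_ne (by exact_mod_cast hn.symm)] at h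
      simpa [fourierCoeff] using h.symm
  refine measure_ext_of_integral_fourier fun n => ?_
  obtain ⟨n, rfl | rfl⟩ := n.eq_nat_or_neg
  · exact key n
  · simp only [fourier_neg]
    rw [integral_conj, integral_conj, key n]

/-! ### Composition with φ as an isometry of H^2 onto H^2_φ; basis and kernel -/

section Composition

variable {φ : hardySpace ∞} (hφ : IsInnerFunction φ) (hφ0 : hInfEval φ 0 = 0)

/-- Composition with the boundary map of an inner function vanishing at `0`, on `L^p`. -/
def compLp (p : ℝ≥0∞) [Fact (1 ≤ p)] : Lp ℂ p circleMeasure →ₗᵢ[ℂ] Lp ℂ p circleMeasure :=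
  Lp.compMeasurePreservingₗᵢ ℂ (boundaryMap φ) (measurePreserving_boundaryMap hφ hφ0)

theorem coeFn_compLp (p : ℝ≥0∞) [Fact (1 ≤ p)] (f : Lp ℂ p circleMeasure) :
    compLp hφ hφ0 p f =ᵐ[circleMeasure] f ∘ boundaryMap φ :=
  Lp.coeFn_compMeasurePreserving f (measurePreserving_boundaryMap hφ hφ0)

theorem compLp_fourierLp (n : ℕ) :
    compLp hφ hφ0 2 (fourierLp 2 (n : ℤ)) = hInfToH2 (hInfPow φ n) := by
  apply Lp.ext
  filter_upwards [coeFn_compLp hφ hφ0 2 (fourierLp 2 (n : ℤ)), hφ, coeFn_hInfPow φ n,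
    coeFn_hInfToH2 (hInfPow φ n), (measurePreserving_boundaryMap hφ hφ0).quasiMeasurePreserving.ae
      (coeFn_fourierLp 2 (n : ℤ))] with t h1 h2 h3 h4 h5
  rw [h1, h4, h3, Function.comp_apply, h5, fourier_boundaryMap h2]

theorem hasSum_compLp (g : hardySpace 2) :
    HasSum (fun n : ℕ => fourierCoeff (g : Lp ℂ 2 circleMeasure) (n : ℤ) •
      ((hInfToH2 (hInfPow φ n) : hardySpace 2) : Lp ℂ 2 circleMeasure))
      (compLp hφ hφ0 2 g) := by
  have h := (compLp hφ hφ0 2).toContinuousLinearMap.hasSum (hasSum_hardySpace_two g)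
  simpa [compLp_fourierLp] using h

theorem compLp_mem (g : hardySpace 2) : compLp hφ hφ0 2 g ∈ hardySpace 2 := by
  refine isClosed_hardySpace_two.mem_of_tendsto (hasSum_compLp hφ hφ0 g)
    (Filter.Eventually.of_forall fun s => ?_)
  exact Submodule.sum_mem _ fun n _ => Submodule.smul_mem _ _ (hInfToH2 (hInfPow φ n)).2

/-- Composition with an inner function vanishing at `0`, as an isometry of `H^2`. -/
def compH2 : hardySpace 2 →ₗᵢ[ℂ] hardySpace 2 where
  toLinearMap := ((compLp hφ hφ0 2).toLinearMap ∘ₗ (hardySpace 2).subtype).codRestrict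
    (hardySpace 2) (compLp_mem hφ hφ0)
  norm_map' g := (compLp hφ hφ0 2).norm_map g.1

theorem coeFn_compH2 (g : hardySpace 2) :
    (compH2 hφ hφ0 g : Lp ℂ 2 circleMeasure) =ᵐ[circleMeasure]
      (g : Lp ℂ 2 circleMeasure) ∘ boundaryMap φ := coeFn_compLp hφ hφ0 2 g.1

theorem hasSum_compH2 (g : hardySpace 2) :
    HasSum (fun n : ℕ => fourierCoeff (g : Lp ℂ 2 circleMeasure) (n : ℤ) •
      hInfToH2 (hInfPow φ n)) (compH2 hφ hφ0 g) := by
  have h : Topology.IsInducing (hardySpace 2).subtype := Topology.IsInducing.subtypeVal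
  exact (h.hasSum_iff _ _).1 (hasSum_compLp hφ hφ0 g)

/-- The monomial `z ^ n` as an element of `H^2`. -/
def monomialH2 (n : ℕ) : hardySpace 2 :=
  ⟨fourierLp 2 (n : ℤ), fun m hm => by
    rw [fourierCoeff_congr_ae (coeFn_fourierLp 2 (n : ℤ)), fourierCoeff_fourier,
      Pi.single_eq_of_ne (by lia)]⟩

theorem compH2_monomialH2 (n : ℕ) : compH2 hφ hφ0 (monomialH2 n) = hInfToH2 (hInfPow φ n) :=
  Subtype.ext (compLp_fourierLp hφ hφ0 n)

theorem orthonormal_monomialH2 : Orthonormal ℂ monomialH2 := by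
  have h := (orthonormal_fourier (T := 1)).comp (Nat.cast : ℕ → ℤ) Nat.cast_injective
  exact ⟨fun n => h.1 n, fun m n hmn => h.2 hmn⟩

include hφ hφ0 in
theorem orthonormal_pow : Orthonormal ℂ fun n => hInfToH2 (hInfPow φ n) := by
  have h := orthonormal_monomialH2.comp_linearIsometry (compH2 hφ hφ0)
  simpa only [Function.comp_def, compH2_monomialH2] using h

theorem mem_hardyTwoOf_pow (φ : hardySpace ∞) (n : ℕ) : hInfToH2 (hInfPow φ n) ∈ hardyTwoOf φ :=
  subset_closure (Submodule.subset_span ⟨n, rfl⟩)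

theorem compH2_mem (g : hardySpace 2) : compH2 hφ hφ0 g ∈ hardyTwoOf φ := by
  refine (Submodule.isClosed_topologicalClosure _).mem_of_tendsto (hasSum_compH2 hφ hφ0 g)
    (Filter.Eventually.of_forall fun s => ?_)
  exact Submodule.sum_mem _ fun n _ => Submodule.smul_mem _ _ (mem_hardyTwoOf_pow φ n)

/-- The range of an isometry of a complete space is closed, and it contains every φ^n as the image
of z^n. -/
theorem mem_hardyTwoOf_iff {f : hardySpace 2} :
    f ∈ hardyTwoOf φ ↔ ∃ g, compH2 hφ hφ0 g = f := by
  refine ⟨fun hf => ?_, ?_⟩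
  · have hcl : IsClosed (Set.range (compH2 hφ hφ0)) :=
      (compH2 hφ hφ0).isometry.isClosedEmbedding.isClosed_range
    refine closure_minimal (t := Set.range (compH2 hφ hφ0)) ?_ hcl hf
    have : Submodule.span ℂ (Set.range fun n : ℕ => hInfToH2 (hInfPow φ n)) ≤
        LinearMap.range (compH2 hφ hφ0).toLinearMap := by
      rw [Submodule.span_le]
      rintro _ ⟨n, rfl⟩
      exact ⟨monomialH2 n, compH2_monomialH2 hφ hφ0 n⟩
    exact this
  · rintro ⟨g, rfl⟩
    exact compH2_mem hφ hφ0 g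

include hφ hφ0 in
theorem orthonormal_pow_hardyTwoOf : Orthonormal ℂ fun n =>
    (⟨hInfToH2 (hInfPow φ n), mem_hardyTwoOf_pow φ n⟩ : hardyTwoOf φ) :=
  ⟨fun n => (orthonormal_pow hφ hφ0).1 n, fun _ _ hmn => (orthonormal_pow hφ hφ0).2 hmn⟩

/-- The powers of an inner function `φ` vanishing at `0`, as a Hilbert basis of `H^2_φ`. -/
def powBasis : HilbertBasis ℕ ℂ (hardyTwoOf φ) :=
  HilbertBasis.mkOfOrthogonalEqBot (orthonormal_pow_hardyTwoOf hφ hφ0) (by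
      rw [Submodule.eq_bot_iff]
      intro h hh
      -- Orthogonality inside H^2_φ is moved to the ambient H^2, where it passes to the closure of
      -- the span; h lies in that closure, so h is orthogonal to itself.
      have h1 : (h : hardySpace 2) ∈
          (Submodule.span ℂ (Set.range fun n : ℕ => hInfToH2 (hInfPow φ n)))ᗮ := by
        rw [Submodule.mem_orthogonal]
        intro u hu
        induction hu using Submodule.span_induction with
        | mem x hx =>
          obtain ⟨n, rfl⟩ := hx
          exact (Submodule.mem_orthogonal _ _).1 hh _ (Submodule.subset_span ⟨n, rfl⟩)
        | zero => simp
        | add x y _ _ hx hy => rw [inner_add_left, hx, hy, add_zero]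
        | smul c x _ hx => rw [inner_smul_left, hx, mul_zero]
      rw [← Submodule.orthogonal_closure] at h1
      have h2 := (Submodule.mem_orthogonal _ _).1 h1 h h.2
      exact Subtype.ext (inner_self_eq_zero.1 h2))

theorem coe_powBasis (n : ℕ) :
    ((powBasis hφ hφ0 n : hardyTwoOf φ) : hardySpace 2) = hInfToH2 (hInfPow φ n) := by
  rw [powBasis, HilbertBasis.coe_mkOfOrthogonalEqBot]

theorem hardyTwoOf_apply (h : hardyTwoOf φ) (z : 𝔻) : h z = hardyEvalCLM z h.1 := rfl

theorem powBasis_apply (n : ℕ) (z : 𝔻) : powBasis hφ hφ0 n z = hInfEval φ z ^ n := by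
  rw [hardyTwoOf_apply, coe_powBasis, hardyEvalCLM_hInfToH2, hInfEval_hInfPow]

include hφ hφ0 in
-- The coefficients of the kernel function at z in the basis φ^n have modulus |φ(z)|^n. They are
-- square summable, hence tend to 0, which gives the strict inequality.
theorem norm_hInfEval_lt_one (z : 𝔻) : ‖hInfEval φ z‖ < 1 := by
  have h := ((powBasis hφ hφ0).orthonormal.inner_products_summable
    (RKHS.kerFun (hardyTwoOf φ) z 1)).tendsto_atTop_zero
  have h2 : ∀ n, ‖inner ℂ (powBasis hφ hφ0 n) (RKHS.kerFun (hardyTwoOf φ) z 1)‖ ^ 2 =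
      (‖hInfEval φ z‖ ^ 2) ^ n := by
    intro n
    rw [RKHS.inner_kerFun, powBasis_apply]
    simp [← pow_mul, mul_comm]
  simp only [h2] at h
  rw [tendsto_pow_atTop_nhds_zero_iff, abs_of_nonneg (by positivity)] at h
  exact (pow_lt_one_iff_of_nonneg (norm_nonneg _) two_ne_zero).1 h

include hφ hφ0 in
-- Parseval for the inner product of two kernel functions in the basis φ^n is a geometric series.
theorem kernel_hardyTwoOf (z w : 𝔻) : RKHS.kernel (hardyTwoOf φ) z w 1 =
    1 / (1 - hInfEval φ z * conj (hInfEval φ w)) := by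
  have h := (powBasis hφ hφ0).hasSum_inner_mul_inner (RKHS.kerFun (hardyTwoOf φ) z 1)
    (RKHS.kerFun (hardyTwoOf φ) w 1)
  have h2 : ∀ n, inner ℂ (RKHS.kerFun (hardyTwoOf φ) z 1) (powBasis hφ hφ0 n) *
      inner ℂ (powBasis hφ hφ0 n) (RKHS.kerFun (hardyTwoOf φ) w 1) =
      (hInfEval φ z * conj (hInfEval φ w)) ^ n := by
    intro n
    rw [RKHS.inner_kerFun, RKHS.kerFun_inner, powBasis_apply, powBasis_apply, mul_pow]
    simp
  simp only [h2] at h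
  rw [RKHS.kerFun_inner, RKHS.kerFun_apply] at h
  have hlt : ‖hInfEval φ z * conj (hInfEval φ w)‖ < 1 := by
    rw [norm_mul, RCLike.norm_conj]
    exact mul_lt_one_of_nonneg_of_lt_one_left (norm_nonneg _) (norm_hInfEval_lt_one hφ hφ0 z)
      (norm_hInfEval_lt_one hφ hφ0 w).le
  have h3 := h.unique (hasSum_geometric_of_norm_lt_one hlt)
  simpa [RCLike.inner_apply] using h3

/-- The self-map of the disc given by an inner function vanishing at `0`. -/
def innerDisc (z : 𝔻) : 𝔻 := UnitDisc.mk (hInfEval φ z) (norm_hInfEval_lt_one hφ hφ0 z)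

theorem coe_innerDisc (z : 𝔻) : (innerDisc hφ hφ0 z : ℂ) = hInfEval φ z := rfl

/-- This links the circle to the disc: evaluating the series of g ∘ τ in powers of φ at z gives the
Taylor series of g at φ(z). -/
theorem hardyEvalCLM_compH2 (z : 𝔻) (g : hardySpace 2) :
    hardyEvalCLM z (compH2 hφ hφ0 g) = hardyEvalCLM (innerDisc hφ hφ0 z) g := by
  have h := (hardyEvalCLM z).hasSum (hasSum_compH2 hφ hφ0 g)
  have h2 := (IsHardy.of_hardySpace_two g).hasSum_discExtension (innerDisc hφ hφ0 z)
  refine h.unique ?_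
  rw [hardyEvalCLM_apply (innerDisc hφ hφ0 z)]
  convert h2 using 2 with n
  rw [map_smul, hardyEvalCLM_hInfToH2, hInfEval_hInfPow, smul_eq_mul, coe_innerDisc]

theorem isCompOnDisc_iff {f g : hardySpace ∞} :
    IsCompOnDisc f g φ ↔ compH2 hφ hφ0 (hInfToH2 g) = hInfToH2 f := by
  constructor
  · intro h
    refine eq_of_hardyEvalCLM_eq fun z => ?_
    obtain ⟨w, hw, hfg⟩ := h z
    rw [← coe_innerDisc hφ hφ0, UnitDisc.coe_inj] at hw
    rw [hardyEvalCLM_compH2, hardyEvalCLM_hInfToH2, hardyEvalCLM_hInfToH2, hfg, hw]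
  · intro h z
    refine ⟨innerDisc hφ hφ0 z, rfl, ?_⟩
    rw [← hardyEvalCLM_hInfToH2, ← h, hardyEvalCLM_compH2, hardyEvalCLM_hInfToH2]

end Composition

/-! ### Composition on H^∞ -/

section BoundedComposition

variable {φ : hardySpace ∞} (hφ : IsInnerFunction φ) (hφ0 : hInfEval φ 0 = 0)

theorem compLp_top_ae_eq (g : hardySpace ∞) :
    compLp hφ hφ0 ∞ g =ᵐ[circleMeasure] (compH2 hφ hφ0 (hInfToH2 g) : Lp ℂ 2 circleMeasure) := by
  filter_upwards [coeFn_compLp hφ hφ0 ∞ g.1, coeFn_compH2 hφ hφ0 (hInfToH2 g),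
    (measurePreserving_boundaryMap hφ hφ0).quasiMeasurePreserving.ae (coeFn_hInfToH2 g)]
    with t h1 h2 h3
  rw [h1, h2, Function.comp_apply, Function.comp_apply, h3]

/-- Composition with an inner function vanishing at `0`, on `H^∞`. -/
def compHInf (g : hardySpace ∞) : hardySpace ∞ :=
  ⟨compLp hφ hφ0 ∞ g, fun n hn => by
    rw [fourierCoeff_congr_ae (compLp_top_ae_eq hφ hφ0 g)]
    exact (compH2 hφ hφ0 (hInfToH2 g)).2 n hn⟩

theorem norm_compHInf (g : hardySpace ∞) : ‖compHInf hφ hφ0 g‖ = ‖g‖ :=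
  (compLp hφ hφ0 ∞).norm_map g.1

theorem coeFn_compHInf (g : hardySpace ∞) :
    (compHInf hφ hφ0 g : Lp ℂ ∞ circleMeasure) =ᵐ[circleMeasure]
      (g : Lp ℂ ∞ circleMeasure) ∘ boundaryMap φ := coeFn_compLp hφ hφ0 ∞ g.1

theorem hInfToH2_compHInf (g : hardySpace ∞) :
    hInfToH2 (compHInf hφ hφ0 g) = compH2 hφ hφ0 (hInfToH2 g) := by
  apply Subtype.ext
  apply Lp.ext
  exact (coeFn_hInfToH2 _).trans (compLp_top_ae_eq hφ hφ0 g)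

theorem isCompOnDisc_compHInf (g : hardySpace ∞) : IsCompOnDisc (compHInf hφ hφ0 g) g φ :=
  (isCompOnDisc_iff hφ hφ0).2 (hInfToH2_compHInf hφ hφ0 g).symm

/-- An element of `H^2` which is bounded on the circle comes from `H^∞`. -/
theorem exists_hInfToH2_eq (g : hardySpace 2) {C : ℝ}
    (h : ∀ᵐ t ∂circleMeasure, ‖(g : Lp ℂ 2 circleMeasure) t‖ ≤ C) :
    ∃ g' : hardySpace ∞, hInfToH2 g' = g := by
  have hm : MemLp ((g : Lp ℂ 2 circleMeasure) : UnitAddCircle → ℂ) ∞ circleMeasure :=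
    memLp_top_of_bound (Lp.memLp g.1).1 C h
  refine ⟨⟨hm.toLp _, fun n hn => ?_⟩, ?_⟩
  · rw [fourierCoeff_congr_ae hm.coeFn_toLp]
    exact g.2 n hn
  · apply Subtype.ext
    apply Lp.ext
    exact (coeFn_hInfToH2 _).trans hm.coeFn_toLp

/-- Here f = g ∘ τ with g in H^2. Since τ carries Lebesgue measure to itself, a bound on g ∘ τ
almost everywhere is the same bound on g. -/
theorem exists_compHInf_eq {f : hardySpace ∞} (hf : hInfToH2 f ∈ hardyTwoOf φ) :
    ∃ g : hardySpace ∞, compHInf hφ hφ0 g = f := by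
  obtain ⟨g, hg⟩ := (mem_hardyTwoOf_iff hφ hφ0).1 hf
  have h1 : ∀ᵐ t ∂circleMeasure, ‖(g : Lp ℂ 2 circleMeasure) (boundaryMap φ t)‖ ≤ ‖f.1‖ := by
    have h2 := coeFn_compH2 hφ hφ0 g
    rw [hg] at h2
    filter_upwards [h2, coeFn_hInfToH2 f, norm_coeFn_le f.1] with t h2 h3 h4
    rw [Function.comp_apply] at h2
    rw [← h2, h3]
    exact h4
  have h2 : ∀ᵐ t ∂circleMeasure, ‖(g : Lp ℂ 2 circleMeasure) t‖ ≤ ‖f.1‖ := by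
    have hmp := measurePreserving_boundaryMap hφ hφ0
    have h := (ae_map_iff hmp.measurable.aemeasurable
      (measurableSet_le (Lp.stronglyMeasurable g.1).measurable.norm measurable_const)).2 h1
    rwa [hmp.map_eq] at h
  obtain ⟨g', rfl⟩ := exists_hInfToH2_eq g h2
  exact ⟨g', hInfToH2_injective (by rw [hInfToH2_compHInf, hg])⟩

end BoundedComposition

/-! ### The weak-star closed span of the powers of φ -/

section WeakStar

/-- If u is orthogonal to H^2_φ, its conjugate lies in L^2 ⊆ L^1, so pairing with u is weak-star
continuous. It vanishes on the powers of φ, hence at f; the double orthogonal complement is the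
closed span. -/
theorem hInfToH2_mem_of_mem_hardyInfOf {φ f : hardySpace ∞} (hf : f ∈ hardyInfOf φ) :
    hInfToH2 f ∈ hardyTwoOf φ := by
  rw [hardyTwoOf, ← Submodule.orthogonal_orthogonal_eq_closure, Submodule.mem_orthogonal]
  intro u hu
  have hconj : MemLp (fun t => conj ((u : Lp ℂ 2 circleMeasure) t)) 1 circleMeasure :=
    ((Lp.memLp u.1).star).mono_exponent one_le_two
  have key : ∀ g : hardySpace ∞, inner ℂ u (hInfToH2 g) =
      ∫ t, (g : Lp ℂ ∞ circleMeasure) t * hconj.toLp _ t ∂circleMeasure := by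
    intro g
    rw [Submodule.coe_inner, L2.inner_def]
    refine integral_congr_ae ?_
    filter_upwards [coeFn_hInfToH2 g, hconj.coeFn_toLp] with t h1 h2
    rw [h1, h2, RCLike.inner_apply]
  have hclosed : IsClosed[hInfWeakStar] {g : hardySpace ∞ |
      ∫ t, (g : Lp ℂ ∞ circleMeasure) t * hconj.toLp _ t ∂circleMeasure = 0} := by
    have h1 : IsClosed {x : Lp ℂ 1 circleMeasure → ℂ | x (hconj.toLp _) = 0} :=
      isClosed_singleton.preimage (continuous_apply _)
    exact @IsClosed.preimage _ _ hInfWeakStar _ _ continuous_induced_dom _ h1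
  rw [key]
  refine (@closure_minimal _ hInfWeakStar _ _ ?_ hclosed) hf
  intro g hg
  rw [Set.mem_ofPred_eq, ← key]
  refine (Submodule.mem_orthogonal' _ _).1 hu _ ?_
  have hle : Submodule.span ℂ (Set.range fun n : ℕ => hInfPow φ n) ≤
      (Submodule.span ℂ (Set.range fun n : ℕ => hInfToH2 (hInfPow φ n))).comap
        ({ toFun := hInfToH2
           map_add' := fun a b => by
            apply Subtype.ext
            apply Lp.ext
            filter_upwards [coeFn_hInfToH2 (a + b), coeFn_hInfToH2 a, coeFn_hInfToH2 b,
              Lp.coeFn_add a.1 b.1, Lp.coeFn_add (hInfToH2 a).1 (hInfToH2 b).1]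
              with t h1 h2 h3 h4 h5
            rw [h1, Submodule.coe_add, Submodule.coe_add, h4, h5, Pi.add_apply,
              Pi.add_apply, h2, h3]
           map_smul' := fun c a => by
            apply Subtype.ext
            apply Lp.ext
            filter_upwards [coeFn_hInfToH2 (c • a), coeFn_hInfToH2 a,
              Lp.coeFn_smul c a.1, Lp.coeFn_smul c (hInfToH2 a).1] with t h1 h2 h4 h5
            rw [h1, RingHom.id_apply, Submodule.coe_smul, Submodule.coe_smul, h4, h5,
              Pi.smul_apply, Pi.smul_apply, h2] } : hardySpace ∞ →ₗ[ℂ] hardySpace 2) := by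
    rw [Submodule.span_le]
    rintro _ ⟨n, rfl⟩
    exact Submodule.subset_span ⟨n, rfl⟩
  exact hle hg

/-- By dominated convergence, uniformly bounded almost everywhere convergence implies weak-star
convergence. -/
theorem mem_hardyInfOf_of_tendsto {φ f : hardySpace ∞} (p : ℕ → hardySpace ∞) (C : ℝ)
    (hp : ∀ k, p k ∈ Submodule.span ℂ (Set.range fun n : ℕ => hInfPow φ n))
    (hC : ∀ k, ∀ᵐ t ∂circleMeasure, ‖(p k : Lp ℂ ∞ circleMeasure) t‖ ≤ C)
    (hlim : ∀ᵐ t ∂circleMeasure, Filter.Tendsto (fun k => (p k : Lp ℂ ∞ circleMeasure) t)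
      Filter.atTop (𝓝 ((f : Lp ℂ ∞ circleMeasure) t))) : f ∈ hardyInfOf φ := by
  refine @mem_closure_of_tendsto _ hInfWeakStar _ f _ p Filter.atTop _ ?_
    (Filter.Eventually.of_forall hp)
  rw [nhds_induced, Filter.tendsto_comap_iff, tendsto_pi_nhds]
  intro h
  refine tendsto_integral_of_dominated_convergence (fun t => C * ‖h t‖) (fun k => ?_) ?_
    (fun k => ?_) ?_
  · exact (Lp.aestronglyMeasurable _).mul (Lp.aestronglyMeasurable h)
  · exact (integrable_of_Lp h).norm.const_mul C
  · filter_upwards [hC k] with t ht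
    rw [norm_mul]
    exact mul_le_mul_of_nonneg_right ht (norm_nonneg _)
  · filter_upwards [hlim] with t ht
    exact ht.mul_const _

theorem norm_sq_eq_tsum_fourierCoeff (f : Lp ℂ 2 circleMeasure) :
    ‖f‖ ^ 2 = ∑' n : ℤ, ‖fourierCoeff f n‖ ^ 2 := by
  have h := lp.norm_rpow_eq_tsum (p := 2) (by norm_num) (fourierBasis.repr f)
  rw [LinearIsometryEquiv.norm_map] at h
  simp only [fourierBasis_repr] at h
  exact_mod_cast h

/-- The dilates g(r w) with r → 1 are bounded by ‖g‖, by `norm_hInfEval_le`. Truncating their Taylor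
series costs at most 1 in sup norm. The truncations tend to g in L^2, so a subsequence tends to g
almost everywhere. -/
theorem exists_polynomial_tendsto (g : hardySpace ∞) : ∃ p : ℕ → Polynomial ℂ,
    (∀ k (w : ℂ), ‖w‖ = 1 → ‖(p k).eval w‖ ≤ ‖g‖ + 1) ∧
    ∀ᵐ t ∂circleMeasure, Filter.Tendsto (fun k => (p k).eval (AddCircle.toCircle t : ℂ))
      Filter.atTop (𝓝 ((g : Lp ℂ ∞ circleMeasure) t)) := by
  set a : ℕ → ℂ := fun n => fourierCoeff (g : Lp ℂ ∞ circleMeasure) (n : ℤ) with ha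
  have ha2 : ∀ n : ℤ, fourierCoeff (hInfToH2 g : Lp ℂ 2 circleMeasure) n =
      fourierCoeff (g : Lp ℂ ∞ circleMeasure) n :=
    fun n => fourierCoeff_congr_ae (coeFn_hInfToH2 g) ▸ rfl
  set r : ℕ → ℝ := fun k => 1 - 1 / ((k : ℝ) + 1) with hr
  have hr0 : ∀ k, 0 ≤ r k := fun k => by
    simp only [hr, sub_nonneg]
    rw [div_le_one (by positivity)]
    linarith [k.cast_nonneg (α := ℝ)]
  have hr1 : ∀ k, r k < 1 := fun k => by
    rw [hr]; simp only; linarith [show 0 < 1 / ((k : ℝ) + 1) by positivity]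
  have hrlim : Filter.Tendsto r Filter.atTop (𝓝 1) := by
    simpa [hr] using (tendsto_one_div_add_atTop_nhds_zero_nat (𝕜 := ℝ)).const_sub 1
  have hs : ∀ k, Summable fun n => ‖a n‖ * r k ^ n := by
    intro k
    have h := (IsHardy.of_hardySpace_top g).summable_norm
      (UnitDisc.mk (r k : ℂ) (by simpa [abs_of_nonneg (hr0 k)] using hr1 k))
    simpa [abs_of_nonneg (hr0 k)] using h
  -- The tail bound controls the sup norm; N ≥ k ensures that each coefficient is eventually
  -- included.
  have hN : ∀ k, ∃ N, k ≤ N ∧ ∑' n, ‖a (n + N)‖ * r k ^ (n + N) ≤ 1 := by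
    intro k
    have h := tendsto_sum_nat_add fun n => ‖a n‖ * r k ^ n
    obtain ⟨N, hN⟩ := Filter.eventually_atTop.1 (h.eventually_le_const one_pos)
    exact ⟨max k N, le_max_left _ _, hN _ (le_max_right _ _)⟩
  choose N hkN hN using hN
  set p : ℕ → Polynomial ℂ := fun k =>
    ∑ n ∈ Finset.range (N k), Polynomial.monomial n (a n * (r k : ℂ) ^ n) with hp
  have hpeval : ∀ k w, (p k).eval w = ∑ n ∈ Finset.range (N k), a n * (r k : ℂ) ^ n * w ^ n := by
    intro k w
    rw [hp, Polynomial.eval_finsetSum]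
    simp
  have hbound : ∀ k (w : ℂ), ‖w‖ = 1 → ‖(p k).eval w‖ ≤ ‖g‖ + 1 := by
    intro k w hw
    have hlt : ‖(r k : ℂ) * w‖ < 1 := by
      simpa [hw, abs_of_nonneg (hr0 k)] using hr1 k
    have h1 := (IsHardy.of_hardySpace_top g).hasSum_discExtension (UnitDisc.mk _ hlt)
    have h2 : hInfEval g (UnitDisc.mk _ hlt) = (p k).eval w +
        ∑' n, a (n + N k) * ((r k : ℂ) * w) ^ (n + N k) := by
      rw [hpeval, hInfEval, ← h1.tsum_eq, ← h1.summable.sum_add_tsum_nat_add (N k)]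
      simp only [UnitDisc.coe_mk, mul_pow, ha, mul_assoc]
    have h3 : ‖∑' n, a (n + N k) * ((r k : ℂ) * w) ^ (n + N k)‖ ≤ 1 := by
      refine (tsum_of_norm_bounded ((summable_nat_add_iff (N k)).2 (hs k)).hasSum
        fun n => ?_).trans (hN k)
      rw [norm_mul, norm_pow, norm_mul, hw, mul_one, Complex.norm_real, Real.norm_of_nonneg (hr0 k)]
    have h4 := norm_hInfEval_le g (UnitDisc.mk _ hlt)
    have h5 : (p k).eval w = hInfEval g (UnitDisc.mk _ hlt) -
        ∑' n, a (n + N k) * ((r k : ℂ) * w) ^ (n + N k) := by rw [h2]; ring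
    rw [h5]
    exact (norm_sub_le _ _).trans (add_le_add h4 h3)
  set P : ℕ → Lp ℂ 2 circleMeasure := fun k =>
    ∑ n ∈ Finset.range (N k), (a n * (r k : ℂ) ^ n) • fourierLp 2 (n : ℤ) with hP
  have hPcoe : ∀ k, P k =ᵐ[circleMeasure] fun t => (p k).eval (AddCircle.toCircle t : ℂ) := by
    intro k
    have h1 : ∀ᵐ t ∂circleMeasure, ∀ n : ℤ, (fourierLp 2 n : Lp ℂ 2 circleMeasure) t =
      fourier n t := ae_all_iff.2 fun n => coeFn_fourierLp 2 n
    have h2 : ∀ᵐ t ∂circleMeasure, ∀ n : ℕ, ((a n * (r k : ℂ) ^ n) •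
        (fourierLp 2 (n : ℤ) : Lp ℂ 2 circleMeasure) : Lp ℂ 2 circleMeasure) t =
        (a n * (r k : ℂ) ^ n) • (fourierLp 2 (n : ℤ) : Lp ℂ 2 circleMeasure) t :=
      ae_all_iff.2 fun n => Lp.coeFn_smul _ _
    filter_upwards [h1, h2, Lp.coeFn_finsetSum (Finset.range (N k)) (fun n : ℕ =>
      (a n * (r k : ℂ) ^ n) • (fourierLp 2 (n : ℤ) : Lp ℂ 2 circleMeasure))] with t h1 h2 h3
    rw [hP, h3, Finset.sum_apply, hpeval]
    refine Finset.sum_congr rfl fun n _ => ?_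
    rw [h2, h1, fourier_apply, natCast_zsmul, AddCircle.toCircle_nsmul, Circle.coe_pow, smul_eq_mul]
  have hPcoeff : ∀ k (n : ℤ), fourierCoeff (P k - (hInfToH2 g).1 : Lp ℂ 2 circleMeasure) n =
      ((if n.toNat < N k then (r k : ℂ) ^ n.toNat else 0) - 1) *
        fourierCoeff (g : Lp ℂ ∞ circleMeasure) n := by
    intro k n
    have h1 : ∀ m : ℕ, fourierBasis.repr (fourierLp 2 (m : ℤ) : Lp ℂ 2 circleMeasure) n =
        if n = m then 1 else 0 := by
      intro m
      rw [fourierBasis_repr, fourierCoeff_congr_ae (coeFn_fourierLp 2 (m : ℤ)),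
        fourierCoeff_fourier, Pi.single_apply]
    rw [← fourierBasis_repr, map_sub, lp.coeFn_sub, Pi.sub_apply,
      fourierBasis_repr (hInfToH2 g).1, ha2, hP]
    simp only [map_sum, map_smul, lp.coeFn_sum, Finset.sum_apply, lp.coeFn_smul, Pi.smul_apply, h1]
    rcases lt_or_ge n 0 with hn | hn
    · rw [g.2 n hn, Finset.sum_eq_zero]
      · simp
      · intro m _
        rw [if_neg (by lia), smul_zero]
    · lift n to ℕ using hn
      simp only [Nat.cast_inj, smul_eq_mul, mul_ite, mul_one, mul_zero, Finset.sum_ite_eq,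
        Finset.mem_range, Int.toNat_natCast]
      split_ifs <;> ring
  have hlim : Filter.Tendsto P Filter.atTop (𝓝 (hInfToH2 g).1) := by
    rw [tendsto_iff_norm_sub_tendsto_zero]
    have h1 : Filter.Tendsto (fun k => ‖P k - (hInfToH2 g).1‖ ^ 2) Filter.atTop (𝓝 0) := by
      simp only [norm_sq_eq_tsum_fourierCoeff, hPcoeff]
      have hsum := (hasSum_sq_fourierCoeff (hInfToH2 g).1).summable
      simp only [ha2] at hsum
      -- Dominated convergence for series: each coefficient of g is multiplied by a factor of
      -- modulus at most 1 that tends to 0.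
      rw [← tsum_zero (α := ℝ) (β := ℤ) (L := SummationFilter.unconditional ℤ)]
      refine tendsto_tsum_of_dominated_convergence hsum (fun n => ?_)
        (Filter.Eventually.of_forall fun k n => ?_)
      · have h2 : Filter.Tendsto (fun k => if n.toNat < N k then (r k : ℂ) ^ n.toNat else 0)
            Filter.atTop (𝓝 1) := by
          have h3 : Filter.Tendsto (fun k => (r k : ℂ) ^ n.toNat) Filter.atTop (𝓝 1) := by
            have := ((Complex.continuous_ofReal.tendsto 1).comp hrlim).pow n.toNat
            simpa using this
          refine h3.congr' ?_
          filter_upwards [Filter.eventually_gt_atTop n.toNat] with k hk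
          rw [if_pos (hk.trans_le (hkN k))]
        have h4 := (((h2.sub_const 1).mul_const
          (fourierCoeff (g : Lp ℂ ∞ circleMeasure) n)).norm).pow 2
        simpa using h4
      · rw [Real.norm_of_nonneg (by positivity), norm_mul]
        refine pow_le_pow_left₀ (by positivity) ?_ 2
        refine mul_le_of_le_one_left (norm_nonneg _) ?_
        split_ifs
        · rw [← Complex.ofReal_pow, ← Complex.ofReal_one, ← Complex.ofReal_sub, Complex.norm_real,
            Real.norm_eq_abs, abs_le]
          constructor <;> linarith [pow_nonneg (hr0 k) n.toNat,
            pow_le_one₀ (n := n.toNat) (hr0 k) (hr1 k).le]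
        · simp
    have h2 := h1.sqrt
    simpa using h2
  obtain ⟨ns, hns, hae⟩ := (tendstoInMeasure_of_tendsto_Lp hlim).exists_seq_tendsto_ae
  refine ⟨fun k => p (ns k), fun k => hbound (ns k), ?_⟩
  filter_upwards [hae, ae_all_iff.2 hPcoe, coeFn_hInfToH2 g] with t h1 h2 h3
  rw [← h3]
  simpa only [h2] using h1

theorem exists_eval_hInfPow (φ : hardySpace ∞) (p : Polynomial ℂ) :
    ∃ f ∈ Submodule.span ℂ (Set.range fun n : ℕ => hInfPow φ n),
      (f : Lp ℂ ∞ circleMeasure) =ᵐ[circleMeasure]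
        fun t => p.eval ((φ : Lp ℂ ∞ circleMeasure) t) := by
  induction p using Polynomial.induction_on' with
  | add p q hp hq =>
    obtain ⟨f, hf, hfp⟩ := hp
    obtain ⟨g, hg, hgq⟩ := hq
    refine ⟨f + g, add_mem hf hg, ?_⟩
    filter_upwards [hfp, hgq, Lp.coeFn_add f.1 g.1] with t h1 h2 h3
    rw [Submodule.coe_add, h3, Pi.add_apply, h1, h2, Polynomial.eval_add]
  | monomial n c =>
    refine ⟨c • hInfPow φ n, Submodule.smul_mem _ _ (Submodule.subset_span ⟨n, rfl⟩), ?_⟩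
    filter_upwards [coeFn_hInfPow φ n, Lp.coeFn_smul c (hInfPow φ n).1] with t h1 h2
    rw [Submodule.coe_smul, h2, Pi.smul_apply, h1, Polynomial.eval_monomial, smul_eq_mul]

/-- With p_k the polynomials approximating g, p_k(φ) equals p_k ∘ τ on the circle and stays bounded;
τ pulls null sets back to null sets, so almost everywhere convergence survives composition. -/
theorem compHInf_mem {φ : hardySpace ∞} (hφ : IsInnerFunction φ) (hφ0 : hInfEval φ 0 = 0)
    (g : hardySpace ∞) : compHInf hφ hφ0 g ∈ hardyInfOf φ := by
  obtain ⟨p, hp, hlim⟩ := exists_polynomial_tendsto g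
  choose f hf hfp using fun k => exists_eval_hInfPow φ (p k)
  refine mem_hardyInfOf_of_tendsto f (‖g‖ + 1) hf (fun k => ?_) ?_
  · filter_upwards [hfp k, hφ] with t h1 h2
    rw [h1]
    exact hp k _ h2
  · filter_upwards [ae_all_iff.2 hfp, hφ, coeFn_compHInf hφ hφ0 g,
      (measurePreserving_boundaryMap hφ hφ0).quasiMeasurePreserving.ae hlim] with t h1 h2 h3 h4
    rw [h3, Function.comp_apply]
    simpa only [h1, toCircle_boundaryMap h2] using h4

theorem mem_hardyInfOf_iff_exists {φ : hardySpace ∞} (hφ : IsInnerFunction φ)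
    (hφ0 : hInfEval φ 0 = 0) {f : hardySpace ∞} :
    f ∈ hardyInfOf φ ↔ ∃ g, compHInf hφ hφ0 g = f := by
  refine ⟨fun h => exists_compHInf_eq hφ hφ0 (hInfToH2_mem_of_mem_hardyInfOf h), ?_⟩
  rintro ⟨g, rfl⟩
  exact compHInf_mem hφ hφ0 g

theorem mem_hardyInfOf_iff_mem_hardyTwoOf {φ : hardySpace ∞} (hφ : IsInnerFunction φ)
    (hφ0 : hInfEval φ 0 = 0) {f : hardySpace ∞} :
    f ∈ hardyInfOf φ ↔ hInfToH2 f ∈ hardyTwoOf φ := by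
  refine ⟨hInfToH2_mem_of_mem_hardyInfOf, fun h => ?_⟩
  exact (mem_hardyInfOf_iff_exists hφ hφ0).2 (exists_compHInf_eq hφ hφ0 h)

theorem mem_hardyInfOf_iff_isCompOnDisc {φ : hardySpace ∞} (hφ : IsInnerFunction φ)
    (hφ0 : hInfEval φ 0 = 0) {f : hardySpace ∞} :
    f ∈ hardyInfOf φ ↔ ∃ g : hardySpace ∞, ‖g‖ = ‖f‖ ∧ IsCompOnDisc f g φ := by
  constructor
  · intro hf
    obtain ⟨g, rfl⟩ := (mem_hardyInfOf_iff_exists hφ hφ0).1 hf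
    exact ⟨g, (norm_compHInf hφ hφ0 g).symm, isCompOnDisc_compHInf hφ hφ0 g⟩
  · rintro ⟨g, -, h⟩
    refine (mem_hardyInfOf_iff_exists hφ hφ0).2 ⟨g, hInfToH2_injective ?_⟩
    rw [hInfToH2_compHInf, (isCompOnDisc_iff hφ hφ0).1 h]

end WeakStar

/-! ### From bounded multiplication on L^2 to a pointwise bound -/

/-- If multiplication by `g` is bounded by `C` on a dense subset of `L^2` then `|g| ≤ C`. -/
theorem ae_norm_le_of_forall_eLpNorm_mul_le {g : UnitAddCircle → ℂ}
    (hg : AEStronglyMeasurable g circleMeasure) {C : ℝ} (hC : 0 ≤ C)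
    {D : Set (Lp ℂ 2 circleMeasure)} (hD : Dense D)
    (h : ∀ p ∈ D, eLpNorm (fun t => g t * p t) 2 circleMeasure ≤
      ENNReal.ofReal C * eLpNorm p 2 circleMeasure) :
    ∀ᵐ t ∂circleMeasure, ‖g t‖ ≤ C := by
  have hall : ∀ u : Lp ℂ 2 circleMeasure, eLpNorm (fun t => g t * u t) 2 circleMeasure ≤
      ENNReal.ofReal C * eLpNorm u 2 circleMeasure := by
    intro u
    -- The bound passes from D to u by Fatou along an almost everywhere convergent subsequence.
    obtain ⟨p, hp, hpu⟩ := mem_closure_iff_seq_limit.1 (hD u)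
    obtain ⟨ns, hns, hae⟩ := (tendstoInMeasure_of_tendsto_Lp hpu).exists_seq_tendsto_ae
    have h1 := Lp.eLpNorm_lim_le_liminf_eLpNorm (p := 2) (μ := circleMeasure)
      (f := fun k t => g t * p (ns k) t) (fun k => hg.mul (Lp.aestronglyMeasurable _))
      (fun t => g t * u t) (by
        filter_upwards [hae] with t ht using ht.const_mul _)
    have h2 : Filter.Tendsto (fun k => ENNReal.ofReal C * eLpNorm (p (ns k)) 2 circleMeasure)
        Filter.atTop (𝓝 (ENNReal.ofReal C * eLpNorm u 2 circleMeasure)) := by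
      refine ENNReal.Tendsto.const_mul ?_ (Or.inr ENNReal.ofReal_ne_top)
      have h3 := (hpu.comp hns.tendsto_atTop).enorm
      simpa only [Lp.enorm_def, Function.comp_apply] using h3
    refine h1.trans ?_
    rw [← h2.liminf_eq]
    exact Filter.liminf_le_liminf (Filter.Eventually.of_forall fun k => h _ (hp _))
  obtain ⟨g', hg', hgg'⟩ := hg
  have heps : ∀ n : ℕ, ∀ᵐ t ∂circleMeasure, ‖g' t‖ < C + 1 / ((n : ℝ) + 1) := by
    intro n
    set ε : ℝ := 1 / ((n : ℝ) + 1) with hε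
    have hε0 : 0 < ε := by positivity
    set s : Set UnitAddCircle := {t | C + ε ≤ ‖g' t‖} with hs
    have hsm : MeasurableSet s := measurableSet_le measurable_const hg'.measurable.norm
    -- Testing on the indicator of s yields (C + ε) m ≤ C m, where m is the square root of the
    -- measure of s; hence s is null.
    have hu : MemLp (s.indicator fun _ => (1 : ℂ)) 2 circleMeasure :=
      (memLp_const 1).indicator hsm
    have h1 := hall (hu.toLp _)
    rw [eLpNorm_congr_ae hu.coeFn_toLp, eLpNorm_indicator_const hsm two_ne_zero (by simp)] at h1
    have h2 : eLpNorm (s.indicator fun _ => ((C + ε : ℝ) : ℂ)) 2 circleMeasure ≤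
        eLpNorm (fun t => g t * hu.toLp _ t) 2 circleMeasure := by
      refine eLpNorm_mono_ae ?_
      filter_upwards [hu.coeFn_toLp, hgg'] with t h3 h4
      rw [h3, h4]
      by_cases ht : t ∈ s
      · rw [Set.indicator_of_mem ht, Set.indicator_of_mem ht, mul_one, Complex.norm_real,
          Real.norm_of_nonneg (by positivity)]
        exact ht
      · rw [Set.indicator_of_notMem ht, norm_zero]
        exact norm_nonneg _
    rw [eLpNorm_indicator_const hsm two_ne_zero (by simp)] at h2
    have h3 := h2.trans h1
    rw [← ofReal_norm, Complex.norm_real, Real.norm_of_nonneg (by positivity), enorm_one, one_mul]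
      at h3
    have hs0 : circleMeasure s = 0 := by
      by_contra hne
      set m := circleMeasure s ^ (1 / (2 : ℝ≥0∞).toReal) with hm
      have hm0 : m ≠ 0 := by
        rw [hm]
        simpa using hne
      have hmt : m ≠ ∞ := ENNReal.rpow_ne_top_of_nonneg (by simp) (measure_ne_top _ _)
      rw [ENNReal.mul_le_mul_iff_left hm0 hmt, ENNReal.ofReal_le_ofReal_iff hC] at h3
      linarith
    rw [ae_iff]
    simpa only [not_lt] using hs0
  filter_upwards [ae_all_iff.2 heps, hgg'] with t h1 h2
  rw [h2]
  have h3 : Filter.Tendsto (fun n : ℕ => C + 1 / ((n : ℝ) + 1)) Filter.atTop (𝓝 C) := by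
    simpa using (tendsto_one_div_add_atTop_nhds_zero_nat (𝕜 := ℝ)).const_add C
  exact ge_of_tendsto' h3 fun n => (h1 n).le

/-- A power of the coordinate clears the negative frequencies. It is unimodular on the circle, so
norm estimates for polynomials extend to trigonometric polynomials, which are dense in L^2. -/
theorem exists_polynomial_eq_pow_mul {p : Lp ℂ 2 circleMeasure}
    (hp : p ∈ Submodule.span ℂ (Set.range (@fourierLp 1 _ 2 _))) :
    ∃ (N : ℕ) (P : Polynomial ℂ), ∀ᵐ t ∂circleMeasure,
      P.eval (AddCircle.toCircle t : ℂ) = (AddCircle.toCircle t : ℂ) ^ N * p t := by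
  induction hp using Submodule.span_induction with
  | mem x hx =>
    obtain ⟨n, rfl⟩ := hx
    refine ⟨n.natAbs, Polynomial.X ^ (n + n.natAbs).toNat, ?_⟩
    filter_upwards [coeFn_fourierLp 2 n] with t ht
    rw [ht, fourier_apply, AddCircle.toCircle_zsmul, Circle.coe_zpow, Polynomial.eval_pow,
      Polynomial.eval_X, ← zpow_natCast, ← zpow_natCast, ← zpow_add₀ (Circle.coe_ne_zero _)]
    congr 1
    lia
  | zero =>
    refine ⟨0, 0, ?_⟩
    filter_upwards [Lp.coeFn_zero ℂ 2 circleMeasure] with t ht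
    rw [ht]
    simp
  | add x y _ _ hx hy =>
    obtain ⟨N, P, hP⟩ := hx
    obtain ⟨M, Q, hQ⟩ := hy
    refine ⟨N + M, Polynomial.X ^ M * P + Polynomial.X ^ N * Q, ?_⟩
    filter_upwards [hP, hQ, Lp.coeFn_add x y] with t h1 h2 h3
    rw [h3, Pi.add_apply, Polynomial.eval_add, Polynomial.eval_mul, Polynomial.eval_mul, h1, h2]
    simp only [Polynomial.eval_pow, Polynomial.eval_X]
    ring
  | smul c x _ hx =>
    obtain ⟨N, P, hP⟩ := hx
    refine ⟨N, c • P, ?_⟩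
    filter_upwards [hP, Lp.coeFn_smul c x] with t h1 h2
    rw [h2, Pi.smul_apply, Polynomial.eval_smul, h1, smul_eq_mul, smul_eq_mul]
    ring

/-- If multiplication by `g` is bounded by `C` on polynomials, in the norm of `L^2` of the circle,
then `|g| ≤ C`. -/
theorem ae_norm_le_of_forall_polynomial {g : UnitAddCircle → ℂ}
    (hg : AEStronglyMeasurable g circleMeasure) {C : ℝ} (hC : 0 ≤ C)
    (h : ∀ P : Polynomial ℂ,
      eLpNorm (fun t => P.eval (AddCircle.toCircle t : ℂ) * g t) 2 circleMeasure ≤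
        ENNReal.ofReal C *
          eLpNorm (fun t => P.eval (AddCircle.toCircle t : ℂ)) 2 circleMeasure) :
    ∀ᵐ t ∂circleMeasure, ‖g t‖ ≤ C := by
  refine ae_norm_le_of_forall_eLpNorm_mul_le hg hC
    (D := Submodule.span ℂ (Set.range (@fourierLp 1 _ 2 _))) ?_ ?_
  · rw [← Submodule.dense_iff_topologicalClosure_eq_top.symm]
    exact span_fourierLp_closure_eq_top (by simp)
  · intro p hp
    obtain ⟨N, P, hP⟩ := exists_polynomial_eq_pow_mul hp
    have h1 := h P
    have hn : ∀ t : UnitAddCircle, ‖(AddCircle.toCircle t : ℂ)‖ = 1 := fun t => Circle.norm_coe _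
    rw [eLpNorm_congr_norm_ae (g := fun t => g t * p t) (by
        filter_upwards [hP] with t ht
        rw [ht, norm_mul, norm_mul, norm_mul, norm_pow, hn, one_pow, one_mul, mul_comm]),
      eLpNorm_congr_norm_ae (f := fun t => P.eval (AddCircle.toCircle t : ℂ)) (g := p) (by
        filter_upwards [hP] with t ht
        rw [ht, norm_mul, norm_pow, hn, one_pow, one_mul])] at h1
    exact h1

/-- Closed graph theorem: point evaluations are continuous and separate the elements of H, so the
graph of multiplication is closed. -/
theorem RKHS.exists_continuousLinearMap_of_mem_multiplierAlgebra {X : Type*} {H : Type*}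
    [NormedAddCommGroup H] [InnerProductSpace ℂ H] [CompleteSpace H] [RKHS ℂ H X ℂ] {F : X → ℂ}
    (hF : F ∈ RKHS.multiplierAlgebra H) :
    ∃ T : H →L[ℂ] H, (∀ (h : H) (x : X), T h x = F x * h x) ∧ 0 ≤ ‖T‖ ∧
      (∀ h, ‖T h‖ ≤ ‖T‖ * ‖h‖) ∧ ∀ C, 0 ≤ C → (∀ h, ‖T h‖ ≤ C * ‖h‖) → ‖T‖ ≤ C := by
  choose T hT using hF
  let L : H →ₗ[ℂ] H :=
    { toFun := T
      map_add' := fun a b => RKHS.ext fun x => by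
        rw [hT, RKHS.coe_add, RKHS.coe_add, Pi.add_apply, Pi.add_apply, hT, hT, mul_add]
      map_smul' := fun c a => RKHS.ext fun x => by
        rw [hT, RingHom.id_apply, RKHS.coe_smul, RKHS.coe_smul, Pi.smul_apply, Pi.smul_apply, hT,
          smul_eq_mul, smul_eq_mul, mul_left_comm] }
  refine ⟨ContinuousLinearMap.ofSeqClosedGraph (g := L) fun u x y hu hTu => ?_, fun h x => hT h x,
    norm_nonneg _, ContinuousLinearMap.le_opNorm _,
    fun C hC h => ContinuousLinearMap.opNorm_le_bound _ hC h⟩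
  refine RKHS.ext fun z => ?_
  have h1 := ((RKHS.continuous_eval z).tendsto y).comp hTu
  have h2 := (((RKHS.continuous_eval z).tendsto x).comp hu).const_mul (F z)
  refine (tendsto_nhds_unique h1 (h2.congr fun n => ?_)).trans (hT x z).symm
  exact (hT (u n) z).symm

/-! ### Multipliers of H^2_φ -/

section Multipliers

variable {φ : hardySpace ∞} (hφ : IsInnerFunction φ) (hφ0 : hInfEval φ 0 = 0)

include hφ hφ0 in
-- For a polynomial P, P(φ) = P ∘ τ lies in H^2_φ and T sends it to (P g) ∘ τ. Since τ preserves
-- measure, the bound on T becomes ‖P g‖ ≤ C ‖P‖ in L^2 of the circle.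
theorem ae_norm_le_of_multiplication (T : hardyTwoOf φ → hardyTwoOf φ) {C : ℝ} (hC : 0 ≤ C)
    (hTC : ∀ h, ‖T h‖ ≤ C * ‖h‖) (g : hardySpace 2)
    (hT : ∀ (h : hardyTwoOf φ) (z : 𝔻), T h z = hardyEvalCLM z (compH2 hφ hφ0 g) * h z) :
    ∀ᵐ t ∂circleMeasure, ‖(g : Lp ℂ 2 circleMeasure) t‖ ≤ C := by
  have hmp := measurePreserving_boundaryMap hφ hφ0
  refine ae_norm_le_of_forall_polynomial (Lp.aestronglyMeasurable _) hC fun P => ?_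
  have hPc : AEStronglyMeasurable (fun t : UnitAddCircle => P.eval (AddCircle.toCircle t : ℂ))
      circleMeasure := by
    refine Continuous.aestronglyMeasurable ?_
    have := (AddCircle.continuous_toCircle (T := 1))
    fun_prop
  obtain ⟨f, hf, hfP⟩ := exists_eval_hInfPow φ P
  have hfP' : ∀ᵐ t ∂circleMeasure, (f : Lp ℂ ∞ circleMeasure) t =
      P.eval (AddCircle.toCircle (boundaryMap φ t) : ℂ) := by
    filter_upwards [hfP, hφ] with t h1 h2
    rw [h1, toCircle_boundaryMap h2]
  have hfm : hInfToH2 f ∈ hardyTwoOf φ :=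
    hInfToH2_mem_of_mem_hardyInfOf (@subset_closure _ hInfWeakStar _ _ hf)
  set h : hardyTwoOf φ := ⟨hInfToH2 f, hfm⟩ with hh
  have hprod := IsHardy.top_mul f (IsHardy.of_hardySpace_two (compH2 hφ hφ0 g))
  have hTh : (T h : hardySpace 2) = hprod.toH2 := by
    refine eq_of_hardyEvalCLM_eq fun z => ?_
    rw [hardyEvalCLM_toH2, (IsHardy.of_hardySpace_top f).discExtension_mul
      (IsHardy.of_hardySpace_two _), ← hardyTwoOf_apply, hT, hardyTwoOf_apply, mul_comm,
      hardyEvalCLM_hInfToH2]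
    rfl
  have h1 : eLpNorm (fun t => P.eval (AddCircle.toCircle t : ℂ) * (g : Lp ℂ 2 circleMeasure) t) 2
      circleMeasure = ‖T h‖ₑ := by
    rw [← eLpNorm_comp_measurePreserving (g := fun t : UnitAddCircle =>
      P.eval (AddCircle.toCircle t : ℂ) * (g : Lp ℂ 2 circleMeasure) t)
      (hPc.mul (Lp.aestronglyMeasurable _)) hmp]
    change _ = ‖(T h : hardySpace 2).1‖ₑ
    rw [Lp.enorm_def]
    refine eLpNorm_congr_ae ?_
    have h2 := hprod.coeFn_toH2
    rw [← hTh] at h2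
    filter_upwards [h2, hfP', coeFn_compH2 hφ hφ0 g] with t h2 h3 h4
    rw [h2, h3, h4, Function.comp_apply, Function.comp_apply]
  have h2 : eLpNorm (fun t => P.eval (AddCircle.toCircle t : ℂ)) 2 circleMeasure = ‖h‖ₑ := by
    rw [← eLpNorm_comp_measurePreserving hPc hmp]
    change _ = ‖(hInfToH2 f).1‖ₑ
    rw [Lp.enorm_def]
    refine eLpNorm_congr_ae ?_
    filter_upwards [coeFn_hInfToH2 f, hfP'] with t h3 h4
    rw [h3, h4, Function.comp_apply]
  rw [h1, h2, ← ofReal_norm, ← ofReal_norm, ← ENNReal.ofReal_mul hC]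
  exact ENNReal.ofReal_le_ofReal (hTC h)

theorem hInfEval_compHInf (g : hardySpace ∞) (z : 𝔻) :
    hInfEval (compHInf hφ hφ0 g) z = hInfEval g (innerDisc hφ hφ0 z) := by
  rw [← hardyEvalCLM_hInfToH2, hInfToH2_compHInf, hardyEvalCLM_compH2, hardyEvalCLM_hInfToH2]

/-- Writing h = u ∘ τ, the product is (g u) ∘ τ, and composition with τ is isometric. -/
theorem exists_mul_compHInf (g : hardySpace ∞) (h : hardyTwoOf φ) :
    ∃ k : hardyTwoOf φ, (∀ z, k z = hInfEval (compHInf hφ hφ0 g) z * h z) ∧ ‖k‖ ≤ ‖g‖ * ‖h‖ := by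
  obtain ⟨h, hh⟩ := h
  obtain ⟨u, rfl⟩ := (mem_hardyTwoOf_iff hφ hφ0).1 hh
  have hprod := IsHardy.top_mul g (IsHardy.of_hardySpace_two u)
  refine ⟨⟨compH2 hφ hφ0 hprod.toH2, compH2_mem hφ hφ0 _⟩, fun z => ?_, ?_⟩
  · rw [hardyTwoOf_apply, hardyTwoOf_apply, hardyEvalCLM_compH2, hardyEvalCLM_toH2,
      (IsHardy.of_hardySpace_top g).discExtension_mul (IsHardy.of_hardySpace_two _),
      hInfEval_compHInf, hardyEvalCLM_compH2]
    rfl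
  · change ‖compH2 hφ hφ0 hprod.toH2‖ ≤ ‖g‖ * ‖compH2 hφ hφ0 u‖
    rw [LinearIsometry.norm_map, LinearIsometry.norm_map]
    refine Lp.norm_le_mul_norm_of_ae_le_mul (f := hprod.toH2.1) (g := u.1) ?_
    filter_upwards [hprod.coeFn_toH2, norm_coeFn_le g.1] with t h1 h2
    rw [h1, norm_mul]
    exact mul_le_mul_of_nonneg_right h2 (norm_nonneg _)

include hφ hφ0 in
theorem multiplierAlgebra_hardyTwoOf :
    (RKHS.multiplierAlgebra (hardyTwoOf φ) : Set (𝔻 → ℂ)) = hInfEval '' hardyInfOf φ := by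
  ext F
  constructor
  · intro hF
    obtain ⟨T, hT, hT0, hTle, -⟩ := RKHS.exists_continuousLinearMap_of_mem_multiplierAlgebra hF
    -- The basis vector of index 0 is the constant 1, so its image under T is F itself.
    obtain ⟨g, hg⟩ := (mem_hardyTwoOf_iff hφ hφ0).1 (T (powBasis hφ hφ0 0)).2
    have hFz : ∀ z, F z = hardyEvalCLM z (compH2 hφ hφ0 g) := fun z => by
      rw [hg, ← hardyTwoOf_apply, hT, powBasis_apply, pow_zero, mul_one]
    obtain ⟨g', rfl⟩ := exists_hInfToH2_eq g (ae_norm_le_of_multiplication hφ hφ0 T hT0 hTle g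
      fun h z => by rw [hT, hFz])
    refine ⟨compHInf hφ hφ0 g', compHInf_mem hφ hφ0 g', funext fun z => ?_⟩
    rw [hFz, ← hardyEvalCLM_hInfToH2, hInfToH2_compHInf]
  · rintro ⟨f, hf, rfl⟩
    obtain ⟨g, rfl⟩ := (mem_hardyInfOf_iff_exists hφ hφ0).1 hf
    intro h
    obtain ⟨k, hk, -⟩ := exists_mul_compHInf hφ hφ0 g h
    exact ⟨k, hk⟩

include hφ hφ0 in
theorem exists_multiplication_norm_eq {f : hardySpace ∞} (hf : f ∈ hardyInfOf φ) :
    ∃ T : hardyTwoOf φ →L[ℂ] hardyTwoOf φ,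
      (∀ (h : hardyTwoOf φ) (z : 𝔻), T h z = hInfEval f z * h z) ∧ ‖T‖ = ‖f‖ := by
  have hF : hInfEval f ∈ (RKHS.multiplierAlgebra (hardyTwoOf φ) : Set (𝔻 → ℂ)) := by
    rw [multiplierAlgebra_hardyTwoOf hφ hφ0]
    exact ⟨f, hf, rfl⟩
  obtain ⟨T, hT, hT0, hTle, hTbound⟩ := RKHS.exists_continuousLinearMap_of_mem_multiplierAlgebra hF
  refine ⟨T, hT, ?_⟩
  obtain ⟨g, rfl⟩ := (mem_hardyInfOf_iff_exists hφ hφ0).1 hf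
  rw [norm_compHInf]
  refine le_antisymm (hTbound _ (norm_nonneg g) fun h => ?_) ?_
  · obtain ⟨k, hk, hkn⟩ := exists_mul_compHInf hφ hφ0 g h
    rwa [show T h = k from RKHS.ext fun z => by rw [hT, hk]]
  · have h1 := ae_norm_le_of_multiplication hφ hφ0 T hT0 hTle (hInfToH2 g) fun h z => by
      rw [hT, ← hInfToH2_compHInf, hardyEvalCLM_hInfToH2]
    refine norm_top_le_of_ae g.1 hT0 ?_
    filter_upwards [h1, coeFn_hInfToH2 g] with t h2 h3
    rwa [← h3]

end Multipliers

/-! ### Contractive colligations and transfer functions -/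

section Colligation

/-- Two finite families of vectors with the same Gram matrix are related by a contraction. -/
theorem exists_contraction_of_inner_eq {X ι : Type*} [NormedAddCommGroup X] [InnerProductSpace ℂ X]
    [Fintype ι] (P Q : ι → X) (h : ∀ i j, inner ℂ (P i) (P j) = inner ℂ (Q i) (Q j)) :
    ∃ L : X →L[ℂ] X, ‖L‖ ≤ 1 ∧ ∀ i, L (P i) = Q i := by
  classical
  set p : (ι → ℂ) →ₗ[ℂ] X := Fintype.linearCombination ℂ P with hp
  set q : (ι → ℂ) →ₗ[ℂ] X := Fintype.linearCombination ℂ Q with hq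
  -- Equal Gram matrices give equal norms of corresponding combinations, so P i ↦ Q i is well
  -- defined and isometric on the span; the orthogonal projection onto the span extends it to a
  -- contraction.
  have hnorm : ∀ c, ‖q c‖ = ‖p c‖ := by
    intro c
    have h2 : inner ℂ (q c) (q c) = inner ℂ (p c) (p c) := by
      rw [hp, hq, Fintype.linearCombination_apply, Fintype.linearCombination_apply]
      simp only [sum_inner, inner_sum, inner_smul_left, inner_smul_right, h]
    rw [inner_self_eq_norm_sq_to_K, inner_self_eq_norm_sq_to_K] at h2
    have h3 : ‖q c‖ ^ 2 = ‖p c‖ ^ 2 := by exact_mod_cast h2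
    exact (sq_eq_sq₀ (norm_nonneg _) (norm_nonneg _)).1 h3
  have hker : LinearMap.ker p ≤ LinearMap.ker q := by
    intro c hc
    rw [LinearMap.mem_ker] at hc ⊢
    rw [← norm_eq_zero, hnorm, hc, norm_zero]
  set f : LinearMap.range p →ₗ[ℂ] X :=
    (LinearMap.ker p).liftQ q hker ∘ₗ p.quotKerEquivRange.symm.toLinearMap with hf
  have hfp : ∀ c, f ⟨p c, c, rfl⟩ = q c := by
    intro c
    have : p.quotKerEquivRange.symm ⟨p c, c, rfl⟩ = (LinearMap.ker p).mkQ c := by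
      rw [LinearEquiv.symm_apply_eq]
      rfl
    rw [hf, LinearMap.comp_apply, LinearEquiv.coe_coe, this]
    simp
  set f' : LinearMap.range p →L[ℂ] X := f.mkContinuous 1 (by
    rintro ⟨_, c, rfl⟩
    rw [hfp, hnorm, one_mul]
    exact le_rfl) with hf'
  refine ⟨f' ∘L (LinearMap.range p).orthogonalProjectionOnto, ?_, fun i => ?_⟩
  · refine (ContinuousLinearMap.opNorm_comp_le _ _).trans ?_
    exact mul_le_one₀ (LinearMap.mkContinuous_norm_le _ zero_le_one _) (norm_nonneg _)
      (Submodule.orthogonalProjectionOnto_norm_le _)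
  · have h1 : p (Pi.single i 1) = P i := by simp [hp]
    have h2 : q (Pi.single i 1) = Q i := by simp [hq]
    have h3 := Submodule.orthogonalProjectionOnto_mem_subspace_eq_self
      (⟨p (Pi.single i 1), Pi.single i 1, rfl⟩ : LinearMap.range p)
    rw [ContinuousLinearMap.comp_apply, ← h1, ← h2, h3, ← hfp]
    rfl

variable {E U : Type*} [NormedAddCommGroup E] [InnerProductSpace ℂ E]
  [NormedAddCommGroup U] [InnerProductSpace ℂ U]

/-- The lurking isometry argument: a contractive colligation from an identity of Gram matrices. -/
theorem exists_contractive_colligation [CompleteSpace E] [CompleteSpace U] {ι : Type*} [Fintype ι]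
    (p₁ q₁ : ι → E) (p₂ q₂ : ι → U)
    (h : ∀ i j, inner ℂ (p₁ i) (p₁ j) + inner ℂ (p₂ i) (p₂ j) =
      inner ℂ (q₁ i) (q₁ j) + inner ℂ (q₂ i) (q₂ j)) :
    ∃ (A : E →L[ℂ] E) (B : U →L[ℂ] E) (C : E →L[ℂ] U) (D : U →L[ℂ] U),
      (∀ x u, ‖A x + B u‖ ^ 2 + ‖C x + D u‖ ^ 2 ≤ ‖x‖ ^ 2 + ‖u‖ ^ 2) ∧
      ∀ x u i, inner ℂ (A x + B u) (p₁ i) + inner ℂ (C x + D u) (p₂ i) =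
        inner ℂ x (q₁ i) + inner ℂ u (q₂ i) := by
  obtain ⟨L, hL, hLP⟩ := exists_contraction_of_inner_eq (X := WithLp 2 (E × U))
    (fun i => WithLp.toLp 2 (p₁ i, p₂ i)) (fun i => WithLp.toLp 2 (q₁ i, q₂ i)) (fun i j => by
      simpa [WithLp.prod_inner_apply] using h i j)
  -- The colligation is the block form of the adjoint of the contraction sending (p₁ i, p₂ i) to (q₁
  -- i, q₂ i); the second claim is the adjoint relation.
  set S := L.adjoint with hS
  set e := (WithLp.prodContinuousLinearEquiv 2 ℂ E U).symm with he
  set S₁ : E →L[ℂ] WithLp 2 (E × U) := S ∘L e.toContinuousLinearMap ∘L .inl ℂ E U with hS₁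
  set S₂ : U →L[ℂ] WithLp 2 (E × U) := S ∘L e.toContinuousLinearMap ∘L .inr ℂ E U with hS₂
  have hS12 : ∀ x u, S₁ x + S₂ u = S (WithLp.toLp 2 (x, u)) := by
    intro x u
    simp only [hS₁, hS₂, ContinuousLinearMap.comp_apply, ← map_add]
    simp [he]
  refine ⟨WithLp.fstL 2 ℂ E U ∘L S₁, WithLp.fstL 2 ℂ E U ∘L S₂, WithLp.sndL 2 ℂ E U ∘L S₁,
    WithLp.sndL 2 ℂ E U ∘L S₂, fun x u => ?_, fun x u i => ?_⟩
  · simp only [ContinuousLinearMap.comp_apply, ← map_add, hS12]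
    have h1 : ‖S (WithLp.toLp 2 (x, u))‖ ^ 2 ≤ ‖(WithLp.toLp 2 (x, u) : WithLp 2 (E × U))‖ ^ 2 := by
      refine pow_le_pow_left₀ (norm_nonneg _) ?_ 2
      refine S.le_of_opNorm_le (c := 1) ?_ _ |>.trans (one_mul _).le
      rw [hS, LinearIsometryEquiv.norm_map]
      exact hL
    rw [WithLp.prod_norm_sq_eq_of_L2, WithLp.prod_norm_sq_eq_of_L2] at h1
    exact h1
  · simp only [ContinuousLinearMap.comp_apply, ← map_add, hS12]
    have h1 := ContinuousLinearMap.adjoint_inner_left L (WithLp.toLp 2 (p₁ i, p₂ i))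
      (WithLp.toLp 2 (x, u))
    rw [hLP, ← hS, WithLp.prod_inner_apply, WithLp.prod_inner_apply] at h1
    exact h1

variable {A : E →L[ℂ] E} {B : U →L[ℂ] E} {C : E →L[ℂ] U} {D : U →L[ℂ] U}

/-- The states of the linear system `x (n + 1) = A (x n) + B (u n)`, `x 0 = 0`. -/
def systemState (A : E →L[ℂ] E) (B : U →L[ℂ] E) (u : ℕ → U) : ℕ → E
  | 0 => 0
  | n + 1 => A (systemState A B u n) + B (u n)

/-- The contractivity inequality bounds output plus new state by input plus old state at each step,
and the state terms telescope. -/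
theorem sum_sq_output_add_sq_state_le
    (h : ∀ x u, ‖A x + B u‖ ^ 2 + ‖C x + D u‖ ^ 2 ≤ ‖x‖ ^ 2 + ‖u‖ ^ 2) (u : ℕ → U) (N : ℕ) :
    ∑ n ∈ Finset.range N, ‖C (systemState A B u n) + D (u n)‖ ^ 2 + ‖systemState A B u N‖ ^ 2 ≤
      ∑ n ∈ Finset.range N, ‖u n‖ ^ 2 := by
  induction N with
  | zero => simp [systemState]
  | succ N ih =>
    rw [Finset.sum_range_succ, Finset.sum_range_succ, systemState]
    linarith [h (systemState A B u N) (u N)]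

/-- The transfer function of a contractive colligation at a point of the disc. -/
theorem exists_transfer [CompleteSpace E]
    (h : ∀ x u, ‖A x + B u‖ ^ 2 + ‖C x + D u‖ ^ 2 ≤ ‖x‖ ^ 2 + ‖u‖ ^ 2) {l : ℂ} (hl : ‖l‖ < 1) :
    ∃ G : U →ₗ[ℂ] U,
      (∀ u, ∃ ξ, A (l • ξ) + B u = ξ ∧ C (l • ξ) + D u = G u) ∧
      ∀ ξ u y, A (l • ξ) + B u = ξ → C (l • ξ) + D u = y → y = G u := by
  have hA : ‖A‖ ≤ 1 := by
    refine A.opNorm_le_bound zero_le_one fun x => ?_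
    have h1 := h x 0
    simp only [map_zero, add_zero, norm_zero] at h1
    rw [one_mul]
    refine le_of_sq_le_sq ?_ (norm_nonneg _)
    nlinarith [sq_nonneg ‖C x‖]
  have hlA : ‖l • A‖ < 1 := by
    rw [norm_smul]
    exact mul_lt_one_of_nonneg_of_lt_one_left (norm_nonneg _) hl hA
  set T := Units.oneSub (l • A) hlA with hT
  have hT1 : ∀ ξ, (T⁻¹ : (E →L[ℂ] E)ˣ).val (ξ - A (l • ξ)) = ξ := by
    intro ξ
    have h1 := congrArg (fun S : E →L[ℂ] E => S ξ) T.inv_mul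
    simpa [hT] using h1
  have hT2 : ∀ ξ, (T⁻¹ : (E →L[ℂ] E)ˣ).val ξ - A (l • (T⁻¹ : (E →L[ℂ] E)ˣ).val ξ) = ξ := by
    intro ξ
    have h1 := congrArg (fun S : E →L[ℂ] E => S ξ) T.mul_inv
    simpa [hT] using h1
  -- Since ‖l A‖ < 1, the state equation has the unique solution ξ = (1 - l A)⁻¹ B u, so G = D + l C
  -- (1 - l A)⁻¹ B.
  refine ⟨(C ∘L (l • (T⁻¹ : (E →L[ℂ] E)ˣ).val) ∘L B + D).toLinearMap, fun u => ?_, ?_⟩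
  · exact ⟨(T⁻¹ : (E →L[ℂ] E)ˣ).val (B u), by
      rw [← sub_eq_iff_eq_add'.1 (hT2 (B u))], rfl⟩
  · intro ξ u y h1 h2
    have h3 : (T⁻¹ : (E →L[ℂ] E)ˣ).val (B u) = ξ := by
      rw [← hT1 ξ]
      congr 1
      rw [eq_sub_iff_add_eq', h1]
    rw [← h2, ← h3]
    rfl

end Colligation

/-! ### Necessity of positivity of the Pick matrix -/

namespace RKHS

variable {X H : Type*} [NormedAddCommGroup H] [InnerProductSpace ℂ H] [CompleteSpace H]
  [RKHS ℂ H X ℂ]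

theorem inner_kerFun_kerFun (x y : X) :
    inner ℂ (kerFun H x (1 : ℂ)) (kerFun H y 1) = kernel H x y 1 := by
  rw [kerFun_inner, kerFun_apply]
  simp

theorem isHermitian_pickMatrix {n k : ℕ} (x : Fin n → X) (W : Fin n → Matrix (Fin k) (Fin k) ℂ) :
    (pickMatrix H x W).IsHermitian := by
  ext p q
  rw [Matrix.conjTranspose_apply, pickMatrix, Matrix.of_apply, Matrix.of_apply, star_mul',
    ← inner_kerFun_kerFun, ← inner_kerFun_kerFun]
  congr 1
  · rw [← Matrix.conjTranspose_apply, Matrix.conjTranspose_sub, Matrix.conjTranspose_one,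
      Matrix.conjTranspose_mul, Matrix.conjTranspose_conjTranspose]
  · exact inner_conj_symm _ _

/-- The quadratic form of the Pick matrix at c is ‖u‖² - ‖v‖², where u is the combination of kernel
functions with coefficients c and v is its image under the adjoint of multiplication by F. -/
theorem IsContractiveMultiplier.posSemidef_pickMatrix {n k : ℕ} {x : Fin n → X}
    {W : Fin n → Matrix (Fin k) (Fin k) ℂ} {F : X → Matrix (Fin k) (Fin k) ℂ}
    (hF : IsContractiveMultiplier H F) (hFW : ∀ i, F (x i) = W i) :
    (pickMatrix H x W).PosSemidef := by
  refine .of_dotProduct_mulVec_nonneg (isHermitian_pickMatrix x W) fun c => ?_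
  set K : Fin n → H := fun i => kerFun H (x i) 1 with hK
  set u : Fin k → H := fun a => ∑ i, c (i, a) • K i with hu
  set v : Fin k → H := fun a => ∑ i, (∑ b, conj (W i b a) * c (i, b)) • K i with hv
  have hform : star c ⬝ᵥ (pickMatrix H x W).mulVec c =
      ∑ a, inner ℂ (u a) (u a) - ∑ a, inner ℂ (v a) (v a) := by
    have hss : ∀ α β : Fin n → ℂ, inner ℂ (∑ i, α i • K i) (∑ j, β j • K j) =
        ∑ i, ∑ j, conj (α i) * β j * inner ℂ (K i) (K j) := by
      intro α β
      rw [sum_inner]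
      refine Finset.sum_congr rfl fun i _ => ?_
      rw [inner_sum]
      refine Finset.sum_congr rfl fun j _ => ?_
      rw [inner_smul_left, inner_smul_right, mul_assoc]
    have h1 : ∀ a, inner ℂ (u a) (u a) =
        ∑ i, ∑ j, conj (c (i, a)) * c (j, a) * inner ℂ (K i) (K j) := by
      exact fun a => hss _ _
    have h2 : ∀ a, inner ℂ (v a) (v a) = ∑ i, ∑ j, ∑ b, ∑ b',
        conj (c (i, b)) * (W i b a * conj (W j b' a)) * c (j, b') * inner ℂ (K i) (K j) := by
      intro a
      rw [hv, hss]
      refine Finset.sum_congr rfl fun i _ => Finset.sum_congr rfl fun j _ => ?_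
      rw [map_sum, Finset.sum_mul_sum, Finset.sum_mul]
      refine Finset.sum_congr rfl fun b _ => ?_
      rw [Finset.sum_mul]
      refine Finset.sum_congr rfl fun b' _ => ?_
      rw [map_mul, Complex.conj_conj]
      ring
    have h3 : star c ⬝ᵥ (pickMatrix H x W).mulVec c = ∑ i, ∑ j, ∑ b, ∑ b',
        conj (c (i, b)) * ((1 - W i * (W j).conjTranspose) b b') * c (j, b') *
          inner ℂ (K i) (K j) := by
      simp only [dotProduct, Matrix.mulVec, Fintype.sum_prod_type, Finset.mul_sum, pickMatrix,
        Matrix.of_apply, ← inner_kerFun_kerFun, Pi.star_apply, RCLike.star_def]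
      refine Finset.sum_congr rfl fun i _ => ?_
      rw [Finset.sum_comm]
      refine Finset.sum_congr rfl fun j _ => Finset.sum_congr rfl fun b _ =>
        Finset.sum_congr rfl fun b' _ => ?_
      ring
    have h4 : ∑ a, inner ℂ (v a) (v a) = ∑ i, ∑ j, ∑ b, ∑ b',
        conj (c (i, b)) * ((W i * (W j).conjTranspose) b b') * c (j, b') *
          inner ℂ (K i) (K j) := by
      simp only [h2]
      rw [Finset.sum_comm]
      refine Finset.sum_congr rfl fun i _ => ?_
      rw [Finset.sum_comm]
      refine Finset.sum_congr rfl fun j _ => ?_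
      rw [Finset.sum_comm]
      refine Finset.sum_congr rfl fun b _ => ?_
      rw [Finset.sum_comm]
      refine Finset.sum_congr rfl fun b' _ => ?_
      simp only [Matrix.mul_apply, Matrix.conjTranspose_apply, RCLike.star_def, Finset.mul_sum,
        Finset.sum_mul]
    have h5 : ∑ a, inner ℂ (u a) (u a) = ∑ i, ∑ j, ∑ b, ∑ b',
        conj (c (i, b)) * ((1 : Matrix (Fin k) (Fin k) ℂ) b b') * c (j, b') *
          inner ℂ (K i) (K j) := by
      simp only [h1, Matrix.one_apply, mul_ite, ite_mul, mul_one, mul_zero, zero_mul,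
        Finset.sum_ite_eq, Finset.mem_univ, if_true]
      rw [Finset.sum_comm]
      refine Finset.sum_congr rfl fun i _ => ?_
      rw [Finset.sum_comm]
    rw [h3, h4, h5]
    simp only [← Finset.sum_sub_distrib, Matrix.sub_apply, mul_sub, sub_mul]
  -- The adjoint operator is never formed: with g = F v, the reproducing property gives ⟨u, g⟩ =
  -- ‖v‖², while ‖g‖ ≤ ‖v‖, and Cauchy–Schwarz yields ‖v‖ ≤ ‖u‖.
  obtain ⟨g, hg, hgn⟩ := hF v
  have hcross : ∑ a, inner ℂ (u a) (g a) = ∑ a, inner ℂ (v a) (v a) := by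
    have h1 : ∀ a, inner ℂ (u a) (g a) =
        ∑ i, ∑ b, conj (c (i, a)) * W i a b * v b (x i) := by
      intro a
      simp only [hu, sum_inner, inner_smul_left, hK, kerFun_inner, hg, hFW]
      refine Finset.sum_congr rfl fun i _ => ?_
      rw [RCLike.inner_apply, map_one, mul_one, Finset.mul_sum]
      exact Finset.sum_congr rfl fun b _ => (mul_assoc _ _ _).symm
    have h2 : ∀ b, inner ℂ (v b) (v b) =
        ∑ i, ∑ a, conj (c (i, a)) * W i a b * v b (x i) := by
      intro b
      conv_lhs => rw [hv]
      simp only [sum_inner, inner_smul_left, hK, kerFun_inner]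
      refine Finset.sum_congr rfl fun i _ => ?_
      rw [map_sum, Finset.sum_mul]
      refine Finset.sum_congr rfl fun a _ => ?_
      rw [RCLike.inner_apply, map_one, mul_one, map_mul, Complex.conj_conj]
      ring
    simp only [h1, h2]
    rw [Finset.sum_comm]
    conv_rhs => rw [Finset.sum_comm]
    exact Finset.sum_congr rfl fun i _ => Finset.sum_comm
  have hsq : ∀ w : Fin k → H, ∑ a, inner ℂ (w a) (w a) = ((∑ a, ‖w a‖ ^ 2 : ℝ) : ℂ) := by
    intro w
    rw [Complex.ofReal_sum]
    refine Finset.sum_congr rfl fun a _ => ?_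
    rw [inner_self_eq_norm_sq_to_K]
    simp
  have hle : ∑ a, ‖v a‖ ^ 2 ≤ ∑ a, ‖u a‖ ^ 2 := by
    have h1 : ∑ a, ‖v a‖ ^ 2 ≤ ∑ a, ‖u a‖ * ‖g a‖ := by
      have h2 : ‖∑ a, inner ℂ (u a) (g a)‖ = ∑ a, ‖v a‖ ^ 2 := by
        rw [hcross, hsq, Complex.norm_real, Real.norm_of_nonneg (by positivity)]
      rw [← h2]
      exact (norm_sum_le _ _).trans (Finset.sum_le_sum fun a _ => norm_inner_le_norm _ _)
    have h3 : ∑ a, ‖u a‖ * ‖g a‖ ≤ ∑ a, (‖u a‖ ^ 2 + ‖g a‖ ^ 2) / 2 :=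
      Finset.sum_le_sum fun a _ => by nlinarith [sq_nonneg (‖u a‖ - ‖g a‖)]
    rw [← Finset.sum_div, Finset.sum_add_distrib] at h3
    linarith
  rw [hform, hsq, hsq, ← Complex.ofReal_sub]
  exact_mod_cast sub_nonneg.2 hle

end RKHS

/-! ### Sufficiency: interpolation by transfer functions -/

theorem HilbertBasis.hasSum_norm_sq_repr {ι H : Type*} [NormedAddCommGroup H]
    [InnerProductSpace ℂ H] (b : HilbertBasis ι ℂ H) (h : H) :
    HasSum (fun i => ‖b.repr h i‖ ^ 2) (‖h‖ ^ 2) := by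
  have h1 := lp.hasSum_norm (p := 2) (by norm_num) (b.repr h)
  rw [LinearIsometryEquiv.norm_map] at h1
  exact_mod_cast h1

namespace RKHS

variable {X H : Type*} [NormedAddCommGroup H] [InnerProductSpace ℂ H] [RKHS ℂ H X ℂ]

theorem hasSum_repr_apply {b : HilbertBasis ℕ ℂ H} {l : X → ℂ} (hb : ∀ n x, b n x = l x ^ n)
    (h : H) (x : X) : HasSum (fun n => l x ^ n * b.repr h n) (h x) := by
  let ev : H →L[ℂ] ℂ := (ContinuousLinearMap.proj x).comp (coeCLM ℂ)
  have h1 := ev.hasSum (b.hasSum_repr h)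
  have h2 : ∀ n, ev (b.repr h n • b n) = l x ^ n * b.repr h n := by
    intro n
    rw [map_smul, smul_eq_mul, mul_comm, ← hb]
    rfl
  simp only [h2] at h1
  exact h1

variable {E : Type*} [NormedAddCommGroup E] [InnerProductSpace ℂ E] [CompleteSpace E] {k : ℕ}
  {A : E →L[ℂ] E} {B : EuclideanSpace ℂ (Fin k) →L[ℂ] E} {C : E →L[ℂ] EuclideanSpace ℂ (Fin k)}
  {D : EuclideanSpace ℂ (Fin k) →L[ℂ] EuclideanSpace ℂ (Fin k)}

/-- The transfer function of a contractive colligation, composed with `l`, is a contractive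
multiplier of a space with orthonormal basis `1, l, l ^ 2, …`. -/
theorem isContractiveMultiplier_of_transfer (b : HilbertBasis ℕ ℂ H) {l : X → ℂ}
    (hl : ∀ x, ‖l x‖ < 1) (hb : ∀ n x, b n x = l x ^ n)
    (hc : ∀ x u, ‖A x + B u‖ ^ 2 + ‖C x + D u‖ ^ 2 ≤ ‖x‖ ^ 2 + ‖u‖ ^ 2)
    (F : X → Matrix (Fin k) (Fin k) ℂ)
    (hF : ∀ x ξ u y, A (l x • ξ) + B u = ξ → C (l x • ξ) + D u = y →
      y = (F x).toEuclideanLin u) : IsContractiveMultiplier H F := by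
  intro h
  -- The basis coefficients of h are the input of the linear system; the outputs y will be the
  -- coefficients of the product F h.
  set u : ℕ → EuclideanSpace ℂ (Fin k) := fun n => WithLp.toLp 2 fun j => b.repr (h j) n with hu
  set s : ℕ → E := systemState A B u with hs
  set y : ℕ → EuclideanSpace ℂ (Fin k) := fun n => C (s n) + D (u n) with hy
  set M : ℝ := ∑ j, ‖h j‖ ^ 2 with hM
  have husum : HasSum (fun n => ‖u n‖ ^ 2) M := by
    simp only [EuclideanSpace.norm_sq_eq]
    exact hasSum_sum fun j _ => b.hasSum_norm_sq_repr (h j)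
  have henergy : ∀ N, ∑ n ∈ Finset.range N, ‖y n‖ ^ 2 + ‖s N‖ ^ 2 ≤ M := fun N =>
    (sum_sq_output_add_sq_state_le hc u N).trans
      (sum_le_hasSum _ (fun n _ => by positivity) husum)
  have hyN : ∀ N, ∑ n ∈ Finset.range N, ‖y n‖ ^ 2 ≤ M := fun N => by
    linarith [henergy N, sq_nonneg ‖s N‖]
  have hysum : Summable fun n => ‖y n‖ ^ 2 :=
    summable_of_sum_range_le (fun n => by positivity) hyN
  have hsN : ∀ N, ‖s N‖ ≤ M + 1 := fun N => by
    have h1 : 0 ≤ ∑ n ∈ Finset.range N, ‖y n‖ ^ 2 := by positivity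
    nlinarith [henergy N, sq_nonneg (‖s N‖ - 1)]
  have hmem : ∀ j, Memℓp (fun n => y n j) 2 := fun j => by
    refine memℓp_gen ?_
    refine Summable.of_nonneg_of_le (fun n => by positivity) (fun n => ?_) hysum
    have h1 := PiLp.norm_apply_le (y n) j
    rw [ENNReal.toReal_ofNat, Real.rpow_two]
    exact pow_le_pow_left₀ (norm_nonneg _) h1 2
  set g : Fin k → H := fun j => b.repr.symm ⟨fun n => y n j, hmem j⟩ with hg
  have hgrepr : ∀ j n, b.repr (g j) n = y n j := fun j n => by
    rw [hg, LinearIsometryEquiv.apply_symm_apply]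
  have hgn : ∑ i, ‖g i‖ ^ 2 ≤ M := by
    have h1 : HasSum (fun n => ‖y n‖ ^ 2) (∑ i, ‖g i‖ ^ 2) := by
      simp only [EuclideanSpace.norm_sq_eq, ← hgrepr]
      exact hasSum_sum fun j _ => b.hasSum_norm_sq_repr (g j)
    rw [← h1.tsum_eq]
    exact hysum.tsum_le_of_sum_range_le hyN
  refine ⟨g, fun x i => ?_, hgn⟩
  have hvec : ∀ (w : Fin k → H) (v : ℕ → EuclideanSpace ℂ (Fin k)),
      (∀ j n, b.repr (w j) n = v n j) →
      HasSum (fun n => l x ^ n • v n) (WithLp.toLp 2 fun j => w j x) := by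
    intro w v hwv
    have h1 : HasSum (fun n j => l x ^ n * b.repr (w j) n) fun j => w j x :=
      Pi.hasSum.2 fun j => hasSum_repr_apply hb (w j) x
    have h2 := (PiLp.continuousLinearEquiv 2 ℂ
      fun _ : Fin k => ℂ).symm.toContinuousLinearMap.hasSum h1
    convert h2 using 2 with n
    · ext j
      simp [hwv]
    · rfl
  have hU := hvec h u fun j n => rfl
  have hY := hvec g y hgrepr
  -- The states are bounded, so their generating series converges for |l x| < 1. Its sum ξ starts at
  -- s (n + 1); as s 0 = 0, the unshifted series sums to l x • ξ, and the recursion becomes the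
  -- state equation.
  have hsum : Summable fun n => l x ^ n • s (n + 1) := by
    refine Summable.of_norm_bounded
      ((summable_geometric_of_lt_one (norm_nonneg _) (hl x)).mul_left (M + 1)) fun n => ?_
    rw [norm_smul, norm_pow, mul_comm]
    exact mul_le_mul_of_nonneg_right (hsN _) (by positivity)
  obtain ⟨ξ, hξ⟩ := hsum
  have hS : HasSum (fun n => l x ^ n • s n) (l x • ξ) := by
    have h1 := (hasSum_nat_add_iff (f := fun n => l x ^ n • s n) (g := l x • ξ) 1).1 (by
      simpa only [pow_succ', mul_smul] using hξ.const_smul (l x))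
    have h0 : s 0 = 0 := rfl
    simpa [h0] using h1
  have hstate : A (l x • ξ) + B (WithLp.toLp 2 fun j => h j x) = ξ := by
    refine ((A.hasSum hS).add (B.hasSum hU)).unique ?_
    convert hξ using 2 with n
    rw [map_smul, map_smul, ← smul_add]
    rfl
  have hout : C (l x • ξ) + D (WithLp.toLp 2 fun j => h j x) = WithLp.toLp 2 fun j => g j x := by
    refine ((C.hasSum hS).add (D.hasSum hU)).unique ?_
    convert hY using 2 with n
    rw [map_smul, map_smul, ← smul_add]
  have h1 := congrArg (fun v : EuclideanSpace ℂ (Fin k) => v i) (hF x _ _ _ hstate hout)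
  simpa [Matrix.toLpLin_apply, Matrix.mulVec, dotProduct] using h1

variable [CompleteSpace H]

/-- Factor the Pick matrix as the Gram matrix of vectors β. Multiplying its entries by 1 - l(x_i)
conj(l(x_j)), the reciprocal of the kernel, leaves the entries of I - W_i W_j^*. Moving the negative
terms across gives an equality of Gram matrices, to which the lurking isometry argument applies. -/
theorem exists_isContractiveMultiplier_of_posSemidef (b : HilbertBasis ℕ ℂ H) {l : X → ℂ}
    (hl : ∀ x, ‖l x‖ < 1) (hb : ∀ n x, b n x = l x ^ n)
    (hk : ∀ x y, kernel H x y 1 = 1 / (1 - l x * conj (l y))) {n k : ℕ} {x : Fin n → X}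
    {W : Fin n → Matrix (Fin k) (Fin k) ℂ} (hP : (pickMatrix H x W).PosSemidef) :
    ∃ F : X → Matrix (Fin k) (Fin k) ℂ, IsContractiveMultiplier H F ∧ ∀ i, F (x i) = W i := by
  obtain ⟨m, v, hv⟩ := Matrix.posSemidef_iff_eq_sum_vecMulVec.1 hP
  set β : Fin n × Fin k → EuclideanSpace ℂ (Fin m) := fun p => WithLp.toLp 2 fun i => conj (v i p)
    with hβ
  have hβi : ∀ p q, inner ℂ (β p) (β q) = pickMatrix H x W p q := by
    intro p q
    rw [hv, Matrix.sum_apply, PiLp.inner_apply]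
    refine Finset.sum_congr rfl fun i _ => ?_
    simp [hβ, Matrix.vecMulVec_apply, mul_comm]
  set e : Fin n × Fin k → EuclideanSpace ℂ (Fin k) := fun p => EuclideanSpace.single p.2 1 with he
  -- The vector at (i, a) is W_i^* applied to the a-th standard basis vector.
  set ω : Fin n × Fin k → EuclideanSpace ℂ (Fin k) :=
    fun p => WithLp.toLp 2 fun a => conj (W p.1 p.2 a) with hω
  obtain ⟨A, B, C, D, hc, hadj⟩ := exists_contractive_colligation
    (fun p => conj (l (x p.1)) • β p) β e ω (fun p q => by
      have h1 : inner ℂ (e p) (e q) = (1 : Matrix (Fin k) (Fin k) ℂ) p.2 q.2 := by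
        simp [he, Matrix.one_apply, EuclideanSpace.inner_single_left]
      have h2 : inner ℂ (ω p) (ω q) = (W p.1 * (W q.1).conjTranspose) p.2 q.2 := by
        simp [hω, PiLp.inner_apply, Matrix.mul_apply, mul_comm]
      have h3 : 1 - l (x p.1) * conj (l (x q.1)) ≠ 0 := by
        intro h0
        have h4 : ‖l (x p.1) * conj (l (x q.1))‖ < 1 := by
          rw [norm_mul, RCLike.norm_conj]
          exact mul_lt_one_of_nonneg_of_lt_one_left (norm_nonneg _) (hl _) (hl _).le
        rw [← sub_eq_zero.1 h0, norm_one] at h4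
        exact lt_irrefl _ h4
      have h5 : inner ℂ (β p) (β q) * (1 - l (x p.1) * conj (l (x q.1))) =
          (1 - W p.1 * (W q.1).conjTranspose) p.2 q.2 := by
        rw [hβi, pickMatrix, Matrix.of_apply, hk, mul_assoc, one_div, inv_mul_cancel₀ h3, mul_one]
      rw [Matrix.sub_apply] at h5
      rw [inner_smul_left, inner_smul_right, Complex.conj_conj, h1, h2]
      linear_combination -h5)
  choose G hG hGu using fun z => exists_transfer hc (hl z)
  refine ⟨fun z => Matrix.toEuclideanLin.symm (G z), ?_, fun i => ?_⟩
  · refine isContractiveMultiplier_of_transfer b hl hb hc _ fun z ξ u y h1 h2 => ?_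
    rw [LinearEquiv.apply_symm_apply]
    exact hGu z ξ u y h1 h2
  · rw [LinearEquiv.symm_apply_eq]
    refine LinearMap.ext fun u => ?_
    obtain ⟨ξ, h1, h2⟩ := hG (x i) u
    ext a
    -- In the adjoint relation at the state l ξ, both terms in E equal conj(l) ⟨ξ, β⟩ and cancel,
    -- leaving ⟨G u, e_a⟩ = ⟨u, W_i^* e_a⟩.
    have h3 := hadj (l (x i) • ξ) u (i, a)
    rw [h1, h2, inner_smul_left, inner_smul_right] at h3
    have h4 := add_left_cancel h3
    have h5 := congrArg conj h4
    simpa [he, hω, EuclideanSpace.inner_single_right, PiLp.inner_apply, Matrix.toLpLin_apply,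
      Matrix.mulVec, dotProduct, mul_comm] using h5

theorem isCompleteNevanlinnaPick_of_basis (b : HilbertBasis ℕ ℂ H) {l : X → ℂ}
    (hl : ∀ x, ‖l x‖ < 1) (hb : ∀ n x, b n x = l x ^ n)
    (hk : ∀ x y, kernel H x y 1 = 1 / (1 - l x * conj (l y))) : IsCompleteNevanlinnaPick H :=
  fun _ _ _ _ => ⟨fun ⟨_, hF, hFW⟩ => hF.posSemidef_pickMatrix hFW,
    exists_isContractiveMultiplier_of_posSemidef b hl hb hk⟩

end RKHS

end

theorem proposition6p6 (φ : hardySpace ∞) (hφ : IsInnerFunction φ)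
    (hφ0 : hInfEval φ 0 = 0) :
    -- the powers of `φ` form an orthonormal basis of `H^2_φ`
    (∃ b : HilbertBasis ℕ ℂ (hardyTwoOf φ),
      ∀ n, (b n : hardySpace 2) = hInfToH2 (hInfPow φ n)) ∧
    -- the kernel function of `H^2_φ`
    (∀ z w : 𝔻, RKHS.kernel (hardyTwoOf φ) z w 1 =
      1 / (1 - hInfEval φ z * conj (hInfEval φ w))) ∧
    -- `H^∞_φ = H^2_φ ∩ H^∞ = {g ∘ φ : g ∈ H^∞}`, isometrically
    (∀ f : hardySpace ∞,
      (f ∈ hardyInfOf φ ↔ hInfToH2 f ∈ hardyTwoOf φ) ∧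
      (f ∈ hardyInfOf φ ↔ ∃ g : hardySpace ∞, ‖g‖ = ‖f‖ ∧ IsCompOnDisc f g φ)) ∧
    (∀ g : hardySpace ∞, ∃ f ∈ hardyInfOf φ, ‖f‖ = ‖g‖ ∧ IsCompOnDisc f g φ) ∧
    -- the multiplier algebra of `H^2_φ` is `H^∞_φ`, with equality of norms
    (RKHS.multiplierAlgebra (hardyTwoOf φ) : Set (𝔻 → ℂ)) = hInfEval '' hardyInfOf φ ∧
    (∀ f ∈ hardyInfOf φ, ∃ T : hardyTwoOf φ →L[ℂ] hardyTwoOf φ,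
      (∀ (h : hardyTwoOf φ) (z : 𝔻), T h z = hInfEval f z * h z) ∧ ‖T‖ = ‖f‖) ∧
    -- `H^2_φ` is a complete Nevanlinna-Pick space
    RKHS.IsCompleteNevanlinnaPick (hardyTwoOf φ) :=
  ⟨⟨powBasis hφ hφ0, coe_powBasis hφ hφ0⟩, kernel_hardyTwoOf hφ hφ0,
    fun _ => ⟨mem_hardyInfOf_iff_mem_hardyTwoOf hφ hφ0, mem_hardyInfOf_iff_isCompOnDisc hφ hφ0⟩,
    fun g => ⟨compHInf hφ hφ0 g, compHInf_mem hφ hφ0 g, norm_compHInf hφ hφ0 g,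
      isCompOnDisc_compHInf hφ hφ0 g⟩,
    multiplierAlgebra_hardyTwoOf hφ hφ0, fun _ hf => exists_multiplication_norm_eq hφ hφ0 hf,
    RKHS.isCompleteNevanlinnaPick_of_basis (powBasis hφ hφ0) (norm_hInfEval_lt_one hφ hφ0)
      (powBasis_apply hφ hφ0) (kernel_hardyTwoOf hφ hφ0)⟩
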